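/- Let $n\ge 0$ and let $A\in\mathbb{R}^{n\times n}$ be symmetric. For $x\in\mathbb{R}^n$ let $A[x]$ be the matrix $A$ with its diagonal replaced by $x$, let $\delta(x)=\mathrm{diag}(e^{A[x]})\in\mathbb{R}^n$ be the vector of diagonal entries of the matrix exponential, $D(x)$ the diagonal matrix with diagonal $\delta(x)$, and $g(x)=x-\log\delta(x)$ with the logarithm taken entrywise. (a) For every $x\in\mathbb{R}^n$: all $\delta_i(x)>0$; $g$ is differentiable at $x$; all (complex) eigenvalues of the Jacobian matrix $J(x)$ of $g$ at $x$ are real and lie in $[0,1)$. Moreover, for every spectral decomposition $A[x]=Q\,\mathrm{diag}(\lambda_1,\dots,\lambda_n)\,Q'$ with $Q$ orthogonal, put $\xi_{kl}=e^{\lambda_k}$ if $\lambda_k=\lambda_l$ and $\xi_{kl}=\frac{e^{\lambda_k}-e^{\lambda_l}}{\lambda_k-\lambda_l}$ otherwise, $\varphi_{kl}=\xi_{kk}+\xi_{ll}-2\xi_{kl}$, and let $u_{kl}\in\mathbb{R}^n$ be the entrywise product of the $k$-th and $l$-th columns of $Q$; then, with $D=D(x)$, $$J(x)=D^{-1/2}\,\tilde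 J\,D^{1/2},\qquad \tilde J=\sum_{1\le k<l\le n}\varphi_{kl}\,D^{-1/2}u_{kl}u_{kl}'D^{-1/2},$$ where $\varphi_{kl}\ge 0$ for all $k,l$, with $\varphi_{kl}>0$ whenever $\lambda_k\ne\lambda_l$, and $\tilde J$ is symmetric positive semidefinite. (b) $g$ is a contraction in the following senses. Locally: for every $x$ there are $L\in[0,1)$ and a neighbourhood $U$ of $x$ such that $\|g(y)-g(z)\|_{D(x)}\le L\,\|y-z\|_{D(x)}$ for all $y,z\in U$, where $\|v\|_{D(x)}=\big(\sum_i\delta_i(x)v_i^2\big)^{1/2}$. Globally: there are a complete metric $d$ on $\mathbb{R}^n$ inducing the usual topology and a constant $L\in[0,1)$ with $d(g(x),g(y))\le L\,d(x,y)$ for all $x,y\in\mathbb{R}^n$; moreover $\|x-y\|_\infty\le d(x,y)$ for all $x,y$, and for every $R$ there is $C$ with $d(x,y)\le C\|x-y\|_\infty$ whenever $\|x\|_\infty,\|y\|_\infty\le R$. -/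

import Mathlib

open scoped Topology

noncomputable section

namespace CorrParam

/-- `A[x]`: the matrix `A` with its diagonal replaced by the vector `x`. -/
def withDiag {n : ℕ} (A : Matrix (Fin n) (Fin n) ℝ) (x : Fin n → ℝ) :
    Matrix (Fin n) (Fin n) ℝ :=
  Matrix.of fun i j => if i = j then x i else A i j

/-- `δ(x) = diag(e^{A[x]})`, the vector of diagonal entries of the matrix exponential. -/
def delta {n : ℕ} (A : Matrix (Fin n) (Fin n) ℝ) (x : Fin n → ℝ) : Fin n → ℝ :=
  (NormedSpace.exp (withDiag A x)).diag

/-- `g(x) = x - log diag(e^{A[x]})`, with the logarithm taken entrywise. -/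
def g {n : ℕ} (A : Matrix (Fin n) (Fin n) ℝ) (x : Fin n → ℝ) : Fin n → ℝ :=
  fun i => x i - Real.log (delta A x i)

/-- The Jacobian matrix of `f : ℝⁿ → ℝⁿ` at `x` (meaningful where `f` is differentiable). -/
def jacobian {n : ℕ} (f : (Fin n → ℝ) → (Fin n → ℝ)) (x : Fin n → ℝ) :
    Matrix (Fin n) (Fin n) ℝ :=
  LinearMap.toMatrix' (fderiv ℝ f x).toLinearMap

/-- `ξ_{kl}`: the first divided difference of `exp` at `l_k, l_l`. -/
def xi {n : ℕ} (l : Fin n → ℝ) (k m : Fin n) : ℝ :=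
  if l k = l m then Real.exp (l k) else (Real.exp (l k) - Real.exp (l m)) / (l k - l m)

/-- `φ_{kl} = ξ_{kk} + ξ_{ll} - 2 ξ_{kl}`. -/
def phi {n : ℕ} (l : Fin n → ℝ) (k m : Fin n) : ℝ :=
  xi l k k + xi l m m - 2 * xi l k m

/-- `u_{kl}`: the entrywise product of the `k`-th and `l`-th columns of `Q`. -/
def uvec {n : ℕ} (Q : Matrix (Fin n) (Fin n) ℝ) (k m : Fin n) : Fin n → ℝ :=
  fun i => Q i k * Q i m

/-- `D^{1/2}` for `D = diag(d_1, …, d_n)`. -/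
def sqrtD {n : ℕ} (d : Fin n → ℝ) : Matrix (Fin n) (Fin n) ℝ :=
  Matrix.diagonal fun i => Real.sqrt (d i)

/-- `D^{-1/2}` for `D = diag(d_1, …, d_n)` with positive entries. -/
def invSqrtD {n : ℕ} (d : Fin n → ℝ) : Matrix (Fin n) (Fin n) ℝ :=
  Matrix.diagonal fun i => (Real.sqrt (d i))⁻¹

/-- `∑_{k < l} φ_{kl} D^{-1/2} u_{kl} u_{kl}ᵀ D^{-1/2}` (diagonal terms `k = l` would vanish,
since `φ_{kk} = 0`). -/
def jTilde {n : ℕ} (Q : Matrix (Fin n) (Fin n) ℝ) (l d : Fin n → ℝ) :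
    Matrix (Fin n) (Fin n) ℝ :=
  ∑ k, ∑ m ∈ Finset.Ioi k,
    phi l k m • (invSqrtD d * Matrix.vecMulVec (uvec Q k m) (uvec Q k m) * invSqrtD d)

end CorrParam

end

/-!
The exponential `e^M` of a symmetric matrix `M = Q Λ Qᵀ` is differentiated in two kinds of
directions that together span all matrices: along `V` commuting with `M` the derivative is `e^M V`,
and along a commutator `[M, W]` it is `[e^M, W]`, because conjugation commutes with the exponential.
In the eigenbasis this says that the derivative multiplies the `(k, m)` entry by the divided
difference `ξ_{km}` (`fderiv_exp_orthogonal`). Hence the Jacobian matrix of `δ` is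
`H = ∑ ξ_{km} u_{km} u_{km}ᵀ`, that of `g` is `D⁻¹ (D - H)`, and `D - H` is the matrix
`∑_{k<m} φ_{km} u_{km} u_{km}ᵀ` (`gapMatrix_eq`). Since `φ ≥ 0` and `H` is positive definite,
`0 ≤ D - H < D` as quadratic forms. This places the eigenvalues of the Jacobian matrix in `[0, 1)`
and makes it strictly decrease the `D`-weighted norm; with strict differentiability, `g` is a local
contraction for that norm (`g_locally_contracting`).

There is no uniform local contraction rate, so the global metric comes from the dynamics of `g`. The
potential `F(x) = tr e^{A[x]} - ∑ x_i` satisfies `‖x‖ ≤ F(x)`, and the Golden–Thompson inequality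
`tr e^{B+C} ≤ tr (e^B e^C)` with `B = A[x]` and `C = -diag (log δ(x))` gives
`F(x) - F(g(x)) ≥ ∑ (δ_i(x) - 1 - log δ_i(x))`, which is positive unless `δ(x) = 1`
(`potential_g_lt`). So `g` has exactly one fixed point, and by compactness of the sublevel sets of `F`
the orbits from a ball enter any neighbourhood of it within a bounded number of steps
(`exists_iterate_contracting`). Consequently
`d(x, y) = sup_k L⁻ᵏ ‖g^[k] x - g^[k] y‖` is finite and locally comparable to the norm for some
`L < 1`, and `d(g(x), g(y)) ≤ L d(x, y)` holds by construction (`exists_metricSpace_contracting`).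
-/

noncomputable section

namespace CorrParam

open Matrix

section MatrixExp

attribute [local instance] Matrix.linftyOpNormedRing Matrix.linftyOpNormedAlgebra

/-! ### The derivative of the exponential in a Banach algebra -/

open NormedSpace in
theorem hasStrictFDerivAt_exp_fderiv {𝔸 : Type*} [NormedRing 𝔸] [NormedAlgebra ℝ 𝔸] [CompleteSpace 𝔸]
    (M : 𝔸) : HasStrictFDerivAt exp (fderiv ℝ exp M) M :=
  (exp_analytic (𝕂 := ℝ) M).hasStrictFDerivAt

open NormedSpace in
theorem fderiv_exp_of_commute {𝔸 : Type*} [NormedRing 𝔸] [NormedAlgebra ℝ 𝔸] [CompleteSpace 𝔸]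
    {M V : 𝔸} (h : Commute M V) : fderiv ℝ exp M V = exp M * V := by
  let : NormedAlgebra ℚ 𝔸 := NormedAlgebra.restrictScalars ℚ ℝ 𝔸
  have h1 : HasDerivAt (fun t : ℝ => M + t • V) V 0 := by
    simpa using ((hasDerivAt_id (0 : ℝ)).smul_const V).const_add M
  have h2 : HasDerivAt (fun t : ℝ => exp (M + t • V)) (fderiv ℝ exp M V) 0 := by
    exact (hasStrictFDerivAt_exp_fderiv M).hasFDerivAt.comp_hasDerivAt_of_eq 0 h1 (by simp)
  have h3 : HasDerivAt (fun t : ℝ => exp (M + t • V)) (exp M * V) 0 := by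
    have e : (fun t : ℝ => exp (M + t • V)) = fun t : ℝ => exp M * exp (t • V) := by
      funext t
      exact exp_add_of_commute (h.smul_right t)
    rw [e]
    simpa using (hasDerivAt_exp_smul_const V (0 : ℝ)).const_mul (exp M)
  exact h2.unique h3

open NormedSpace in
/-- In the direction of a commutator `[M, W]` the derivative of `exp` at `M` is `[exp M, W]`:
differentiate `exp (e^{-tW} M e^{tW}) = e^{-tW} (exp M) e^{tW}` at `t = 0`. -/
theorem fderiv_exp_commutator {𝔸 : Type*} [NormedRing 𝔸] [NormedAlgebra ℝ 𝔸] [CompleteSpace 𝔸]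
    (M W : 𝔸) : fderiv ℝ exp M (M * W - W * M) = exp M * W - W * exp M := by
  let : NormedAlgebra ℚ 𝔸 := NormedAlgebra.restrictScalars ℚ ℝ 𝔸
  have hp : HasDerivAt (fun t : ℝ => exp (t • W)) W 0 := by
    simpa using hasDerivAt_exp_smul_const W (0 : ℝ)
  have hm : HasDerivAt (fun t : ℝ => exp (t • (-W))) (-W) 0 := by
    simpa using hasDerivAt_exp_smul_const (-W) (0 : ℝ)
  have hc (N : 𝔸) : HasDerivAt (fun t : ℝ => exp (t • (-W)) * N * exp (t • W)) (N * W - W * N) 0 := by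
    have := (hm.mul_const N).mul hp
    simp only [zero_smul, exp_zero, mul_one, one_mul] at this
    convert! this using 1
    noncomm_ring
  have h2 : HasDerivAt (fun t : ℝ => exp (exp (t • (-W)) * M * exp (t • W)))
      (fderiv ℝ exp M (M * W - W * M)) 0 := by
    exact (hasStrictFDerivAt_exp_fderiv M).hasFDerivAt.comp_hasDerivAt_of_eq 0 (hc M) (by simp)
  have e : (fun t : ℝ => exp (exp (t • (-W)) * M * exp (t • W))) =
      fun t : ℝ => exp (t • (-W)) * exp M * exp (t • W) := by
    funext t
    have hc : Commute (t • (-W)) (t • W) :=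
      (((Commute.refl W).neg_left).smul_left t).smul_right t
    have h1 : exp (t • (-W)) * exp (t • W) = 1 := by
      rw [← exp_add_of_commute hc]; simp
    have h2 : exp (t • W) * exp (t • (-W)) = 1 := by
      rw [← exp_add_of_commute hc.symm]; simp
    exact exp_units_conj (⟨_, _, h1, h2⟩ : 𝔸ˣ) M
  rw [e] at h2
  exact h2.unique (hc (exp M))

variable {n : ℕ}

/-! ### Divided differences of the exponential -/

/-- The scalar inequality behind `φ > 0`: the trapezoidal rule overestimates the integral of `exp`. -/
theorem sub_two_mul_exp_add_pos {t : ℝ} (ht : 0 < t) : 0 < (t - 2) * Real.exp t + t + 2 := by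
  have hd : ∀ s : ℝ, HasDerivAt (fun s : ℝ => (s - 2) * Real.exp s + s + 2)
      ((s - 1) * Real.exp s + 1) s := by
    intro s
    have := ((((hasDerivAt_id s).sub_const 2).mul (Real.hasDerivAt_exp s)).add
      (hasDerivAt_id s)).add_const 2
    convert! this using 1
    simp only [id]
    ring
  have hm : StrictMonoOn (fun s : ℝ => (s - 2) * Real.exp s + s + 2) (Set.Ici 0) := by
    refine strictMonoOn_of_deriv_pos (convex_Ici 0) (by fun_prop) fun s hs => ?_
    rw [interior_Ici, Set.mem_Ioi] at hs
    rw [(hd s).deriv]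
    have h1 := Real.add_one_lt_exp (x := -s) (by linarith)
    have h2 : Real.exp (-s) * Real.exp s = 1 := by rw [← Real.exp_add]; simp
    nlinarith [Real.exp_pos s]
  have := hm (Set.self_mem_Ici) ht.le ht
  norm_num at this
  linarith

theorem xi_symm (l : Fin n → ℝ) (k m : Fin n) : xi l k m = xi l m k := by
  unfold xi
  by_cases h : l k = l m
  · simp [h]
  · rw [if_neg h, if_neg (Ne.symm h), ← neg_sub (Real.exp (l m)), ← neg_sub (l m), neg_div_neg_eq]

theorem phi_symm (l : Fin n → ℝ) (k m : Fin n) : phi l k m = phi l m k := by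
  unfold phi
  rw [xi_symm l k m]
  ring

theorem xi_self (l : Fin n → ℝ) (k : Fin n) : xi l k k = Real.exp (l k) := by simp [xi]

theorem phi_self (l : Fin n → ℝ) (k : Fin n) : phi l k k = 0 := by unfold phi; ring

theorem xi_pos (l : Fin n → ℝ) (k m : Fin n) : 0 < xi l k m := by
  unfold xi
  split_ifs with h
  · exact Real.exp_pos _
  · rcases lt_or_gt_of_ne h with h | h
    · exact div_pos_of_neg_of_neg (by simpa using h) (by linarith)
    · exact div_pos (by simpa using h) (by linarith)

theorem phi_pos_of_lt (l : Fin n → ℝ) {k m : Fin n} (h : l k < l m) : 0 < phi l k m := by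
  have h1 := sub_two_mul_exp_add_pos (sub_pos.2 h)
  have h2 : Real.exp (l m) = Real.exp (l k) * Real.exp (l m - l k) := by
    rw [← Real.exp_add]; congr 1; ring
  have h3 : phi l k m = Real.exp (l k) * ((l m - l k - 2) * Real.exp (l m - l k) + (l m - l k) + 2)
      / (l m - l k) := by
    unfold phi
    rw [xi_self, xi_self, xi_symm, xi, if_neg h.ne', h2]
    have := (sub_pos.2 h).ne'
    field_simp
    ring
  rw [h3]
  exact div_pos (mul_pos (Real.exp_pos _) h1) (sub_pos.2 h)

theorem phi_pos (l : Fin n → ℝ) {k m : Fin n} (h : l k ≠ l m) : 0 < phi l k m := by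
  rcases lt_or_gt_of_ne h with h | h
  · exact phi_pos_of_lt l h
  · rw [phi_symm]; exact phi_pos_of_lt l h

theorem phi_nonneg (l : Fin n → ℝ) (k m : Fin n) : 0 ≤ phi l k m := by
  by_cases h : l k = l m
  · refine le_of_eq ?_
    simp only [phi, xi, h, if_true]
    ring
  · exact (phi_pos l h).le

/-! ### The derivative of `δ` -/

theorem exp_orthogonal_conj {Q : Matrix (Fin n) (Fin n) ℝ} (hQ : Q ∈ Matrix.orthogonalGroup (Fin n) ℝ)
    (l : Fin n → ℝ) : NormedSpace.exp (Q * diagonal l * Qᵀ) =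
      Q * diagonal (fun k => Real.exp (l k)) * Qᵀ := by
  have h1 : Q * Qᵀ = 1 := (Matrix.mem_orthogonalGroup_iff (Fin n) ℝ).1 hQ
  have h2 : Qᵀ * Q = 1 := (Matrix.mem_orthogonalGroup_iff' (Fin n) ℝ).1 hQ
  rw [show (fun k => Real.exp (l k)) = NormedSpace.exp l by
      rw [Pi.exp_def, Real.exp_eq_exp_ℝ]]
  rw [← Matrix.exp_diagonal]
  exact Matrix.exp_units_conj (⟨Q, Qᵀ, h1, h2⟩ : (Matrix (Fin n) (Fin n) ℝ)ˣ) (diagonal l)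

/-- In the eigenbasis, the derivative of `exp` at `Q Λ Qᵀ` acts on the elementary matrix at `(k, m)` as
multiplication by `ξ_{km}`. If `λ_k = λ_m` this matrix commutes with `Λ`; otherwise it is a commutator
with `Λ`. -/
theorem fderiv_exp_single {Q : Matrix (Fin n) (Fin n) ℝ}
    (hQ : Q ∈ Matrix.orthogonalGroup (Fin n) ℝ) (l : Fin n → ℝ) (k m : Fin n) (c : ℝ) :
    fderiv ℝ NormedSpace.exp (Q * diagonal l * Qᵀ) (Q * single k m c * Qᵀ) =
      Q * single k m (xi l k m * c) * Qᵀ := by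
  have h2 : Qᵀ * Q = 1 := (Matrix.mem_orthogonalGroup_iff' (Fin n) ℝ).1 hQ
  have key (X Y : Matrix (Fin n) (Fin n) ℝ) : Q * X * Qᵀ * (Q * Y * Qᵀ) = Q * (X * Y) * Qᵀ := by
    calc _ = Q * X * (Qᵀ * Q) * Y * Qᵀ := by simp only [Matrix.mul_assoc]
      _ = _ := by rw [h2, Matrix.mul_one]; simp only [Matrix.mul_assoc]
  have hs (a b : ℝ) : single k m a - single k m b = single k m (a - b) := by
    ext i j
    rw [Matrix.sub_apply, Matrix.single_apply, Matrix.single_apply, Matrix.single_apply]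
    split_ifs <;> simp
  have hl (d : Fin n → ℝ) (c : ℝ) : diagonal d * single k m c = single k m (d k * c) := by
    ext i j
    rw [Matrix.diagonal_mul, Matrix.single_apply, Matrix.single_apply]
    split_ifs with h
    · rw [h.1]
    · simp
  have hr (d : Fin n → ℝ) (c : ℝ) : single k m c * diagonal d = single k m (d m * c) := by
    ext i j
    rw [Matrix.mul_diagonal, Matrix.single_apply, Matrix.single_apply]
    split_ifs with h
    · rw [h.2, mul_comm]
    · simp
  by_cases h : l k = l m
  · have hc : Commute (Q * diagonal l * Qᵀ) (Q * single k m c * Qᵀ) := by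
      rw [Commute, SemiconjBy, key, key, hl, hr, h]
    have hd : fderiv ℝ NormedSpace.exp (Q * diagonal l * Qᵀ) (Q * single k m c * Qᵀ) =
      NormedSpace.exp (Q * diagonal l * Qᵀ) * (Q * single k m c * Qᵀ) := fderiv_exp_of_commute hc
    rw [hd, exp_orthogonal_conj hQ, key, hl, xi, if_pos h]
  · have hc : Q * single k m c * Qᵀ =
        Q * diagonal l * Qᵀ * (Q * single k m (c / (l k - l m)) * Qᵀ) -
          Q * single k m (c / (l k - l m)) * Qᵀ * (Q * diagonal l * Qᵀ) := by
      rw [key, key, hl, hr, ← Matrix.sub_mul, ← Matrix.mul_sub, hs]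
      congr 3
      have := sub_ne_zero.2 h
      field_simp
    have hd (M W : Matrix (Fin n) (Fin n) ℝ) : fderiv ℝ NormedSpace.exp M (M * W - W * M) =
      NormedSpace.exp M * W - W * NormedSpace.exp M := fderiv_exp_commutator M W
    rw [hc, hd, exp_orthogonal_conj hQ, key, key, hl, hr, ← Matrix.sub_mul,
      ← Matrix.mul_sub, hs, xi, if_neg h]
    congr 3
    have := sub_ne_zero.2 h
    field_simp

/-- The derivative of `exp` at `Q Λ Qᵀ` is, in the eigenbasis, the Hadamard product with the divided
differences `ξ`. -/
theorem fderiv_exp_orthogonal {Q : Matrix (Fin n) (Fin n) ℝ}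
    (hQ : Q ∈ Matrix.orthogonalGroup (Fin n) ℝ) (l : Fin n → ℝ) (V : Matrix (Fin n) (Fin n) ℝ) :
    fderiv ℝ NormedSpace.exp (Q * diagonal l * Qᵀ) V =
      Q * Matrix.of (fun k m => xi l k m * (Qᵀ * V * Q) k m) * Qᵀ := by
  have h1 : Q * Qᵀ = 1 := (Matrix.mem_orthogonalGroup_iff (Fin n) ℝ).1 hQ
  have hV : V = ∑ k, ∑ m, Q * single k m ((Qᵀ * V * Q) k m) * Qᵀ := by
    simp_rw [← Matrix.sum_mul, ← Matrix.mul_sum]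
    rw [← Matrix.matrix_eq_sum_single]
    calc V = (Q * Qᵀ) * V * (Q * Qᵀ) := by simp [h1]
      _ = _ := by simp only [Matrix.mul_assoc]
  conv_lhs => rw [hV]
  simp_rw [map_sum, fderiv_exp_single hQ, ← Matrix.sum_mul, ← Matrix.mul_sum]
  congr 2
  rw [Matrix.matrix_eq_sum_single (Matrix.of fun k m => xi l k m * (Qᵀ * V * Q) k m)]
  rfl

theorem withDiag_eq_add (A : Matrix (Fin n) (Fin n) ℝ) (x : Fin n → ℝ) :
    withDiag A x = withDiag A 0 + diagonal x := by
  ext i j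
  by_cases h : i = j
  · subst h; simp [withDiag]
  · simp [withDiag, h]

theorem hasStrictFDerivAt_withDiag (A : Matrix (Fin n) (Fin n) ℝ) (x : Fin n → ℝ) :
    HasStrictFDerivAt (withDiag A)
      (LinearMap.toContinuousLinearMap (Matrix.diagonalLinearMap (Fin n) ℝ ℝ)) x := by
  rw [show withDiag A = fun y => withDiag A 0 +
      (LinearMap.toContinuousLinearMap (Matrix.diagonalLinearMap (Fin n) ℝ ℝ)) y from
    funext fun y => withDiag_eq_add A y]
  exact (ContinuousLinearMap.hasStrictFDerivAt _).const_add _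

theorem hasStrictFDerivAt_delta (A : Matrix (Fin n) (Fin n) ℝ) (x : Fin n → ℝ) :
    HasStrictFDerivAt (delta A)
      ((LinearMap.toContinuousLinearMap (Matrix.diagLinearMap (Fin n) ℝ ℝ)).comp
        ((fderiv ℝ NormedSpace.exp (withDiag A x)).comp
          (LinearMap.toContinuousLinearMap (Matrix.diagonalLinearMap (Fin n) ℝ ℝ)))) x :=
  (ContinuousLinearMap.hasStrictFDerivAt
    (LinearMap.toContinuousLinearMap (Matrix.diagLinearMap (Fin n) ℝ ℝ))).comp x
    ((hasStrictFDerivAt_exp_fderiv _).comp x (hasStrictFDerivAt_withDiag A x))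

/-- `∑_{k,m} ξ_{km} u_{km} u_{km}ᵀ`, the Jacobian matrix of `δ` at a point where `A[x] = Q Λ Qᵀ`. -/
def deltaJac (Q : Matrix (Fin n) (Fin n) ℝ) (l : Fin n → ℝ) : Matrix (Fin n) (Fin n) ℝ :=
  ∑ k, ∑ m, xi l k m • vecMulVec (uvec Q k m) (uvec Q k m)

theorem hasStrictFDerivAt_delta_of_eq {A : Matrix (Fin n) (Fin n) ℝ} {x : Fin n → ℝ}
    {Q : Matrix (Fin n) (Fin n) ℝ} {l : Fin n → ℝ}
    (hQ : Q ∈ Matrix.orthogonalGroup (Fin n) ℝ) (h : withDiag A x = Q * diagonal l * Qᵀ) :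
    HasStrictFDerivAt (delta A) (LinearMap.toContinuousLinearMap (Matrix.toLin' (deltaJac Q l))) x := by
  convert! hasStrictFDerivAt_delta A x using 1
  refine ContinuousLinearMap.ext fun v => ?_
  change deltaJac Q l *ᵥ v = (fderiv ℝ NormedSpace.exp (withDiag A x) (diagonal v)).diag
  rw [h, fderiv_exp_orthogonal hQ]
  ext i
  have hT (k m : Fin n) : (Qᵀ * diagonal v * Q) k m = uvec Q k m ⬝ᵥ v := by
    rw [Matrix.mul_apply]
    refine Finset.sum_congr rfl fun j _ => ?_
    rw [Matrix.mul_diagonal, Matrix.transpose_apply, uvec]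
    ring
  simp only [deltaJac, Matrix.sum_mulVec, Matrix.smul_mulVec, Matrix.vecMulVec_mulVec,
    Finset.sum_apply, Pi.smul_apply, Matrix.diag_apply, Matrix.mul_apply, Matrix.of_apply,
    Matrix.transpose_apply, Finset.sum_mul, ← hT, smul_eq_mul, uvec, MulOpposite.smul_eq_mul_unop,
    MulOpposite.unop_op]
  rw [Finset.sum_comm]
  refine Finset.sum_congr rfl fun m _ => Finset.sum_congr rfl fun k _ => ?_
  ring

theorem delta_eq {A : Matrix (Fin n) (Fin n) ℝ} {x : Fin n → ℝ}
    {Q : Matrix (Fin n) (Fin n) ℝ} {l : Fin n → ℝ}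
    (hQ : Q ∈ Matrix.orthogonalGroup (Fin n) ℝ) (h : withDiag A x = Q * diagonal l * Qᵀ)
    (i : Fin n) : delta A x i = ∑ k, Real.exp (l k) * Q i k ^ 2 := by
  rw [delta, h, exp_orthogonal_conj hQ, Matrix.diag_apply, Matrix.mul_apply]
  refine Finset.sum_congr rfl fun k _ => ?_
  rw [Matrix.mul_diagonal, Matrix.transpose_apply]
  ring

theorem exists_spectral_decomposition {M : Matrix (Fin n) (Fin n) ℝ} (hM : M.IsSymm) :
    ∃ Q ∈ Matrix.orthogonalGroup (Fin n) ℝ, ∃ l : Fin n → ℝ, M = Q * diagonal l * Qᵀ := by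
  have hH : M.IsHermitian := by
    rw [Matrix.IsHermitian, Matrix.conjTranspose_eq_transpose_of_trivial]; exact hM
  refine ⟨hH.eigenvectorUnitary, hH.eigenvectorUnitary.2, hH.eigenvalues, ?_⟩
  have := hH.spectral_theorem
  rw [Unitary.conjStarAlgAut_apply] at this
  exact this

theorem withDiag_isSymm {A : Matrix (Fin n) (Fin n) ℝ} (hA : A.IsSymm) (x : Fin n → ℝ) :
    (withDiag A x).IsSymm := by
  ext i j
  by_cases h : i = j
  · subst h; rfl
  · simp [withDiag, h, Ne.symm h, hA.apply i j]

end MatrixExp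

section Gap

variable {n : ℕ}

/-! ### The Jacobian matrix of `g` -/

theorem two_mul_sum_Ioi (f : Fin n → Fin n → ℝ) (hs : ∀ k m, f k m = f m k) (h0 : ∀ k, f k k = 0) :
    2 * ∑ k, ∑ m ∈ Finset.Ioi k, f k m = ∑ k, ∑ m, f k m := by
  have h1 : ∑ k, ∑ m ∈ Finset.Iio k, f k m = ∑ k, ∑ m ∈ Finset.Ioi k, f k m := by
    rw [Finset.sum_comm' (t' := Finset.univ) (s' := fun m => Finset.Ioi m) (by simp)]
    exact Finset.sum_congr rfl fun k _ => Finset.sum_congr rfl fun m _ => hs m k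
  have h2 (k : Fin n) : ∑ m, f k m = ∑ m ∈ Finset.Iio k, f k m + ∑ m ∈ Finset.Ioi k, f k m := by
    rw [← Finset.sum_union (by
      rw [Finset.disjoint_left]; intro a ha hb; simp at ha hb; omega)]
    refine (Finset.sum_subset (Finset.subset_univ _) fun m _ hm => ?_).symm
    have : m = k := by
      simp only [Finset.mem_union, Finset.mem_Iio, Finset.mem_Ioi] at hm; omega
    rw [this, h0]
  simp_rw [h2, Finset.sum_add_distrib, h1]
  ring

/-- `∑_{k<m} φ_{km} u_{km} u_{km}ᵀ`, the difference between `D` and the Jacobian matrix of `δ`. -/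
def gapMatrix (Q : Matrix (Fin n) (Fin n) ℝ) (l : Fin n → ℝ) : Matrix (Fin n) (Fin n) ℝ :=
  ∑ k, ∑ m ∈ Finset.Ioi k, phi l k m • vecMulVec (uvec Q k m) (uvec Q k m)

theorem uvec_symm (Q : Matrix (Fin n) (Fin n) ℝ) (k m : Fin n) : uvec Q k m = uvec Q m k := by
  ext i; exact mul_comm _ _

/-- `D - H = ∑_{k<m} φ_{km} u_{km} u_{km}ᵀ`. Orthogonality of `Q` gives
`∑_{k,m} ξ_{kk} u_{km} u_{km}ᵀ = D`, and likewise with `ξ_{mm}`, so the terms of `φ` sum to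
`2 D - 2 H` over all pairs `(k, m)`. -/
theorem gapMatrix_eq {Q : Matrix (Fin n) (Fin n) ℝ} (hQ : Q ∈ Matrix.orthogonalGroup (Fin n) ℝ)
    (l : Fin n → ℝ) : gapMatrix Q l =
      diagonal (fun i => ∑ k, Real.exp (l k) * Q i k ^ 2) - deltaJac Q l := by
  have h1 : Q * Qᵀ = 1 := (Matrix.mem_orthogonalGroup_iff (Fin n) ℝ).1 hQ
  ext i j
  have h2 : ∑ k, ∑ m, xi l k k * (uvec Q k m i * uvec Q k m j) =
      diagonal (fun i => ∑ k, Real.exp (l k) * Q i k ^ 2) i j := by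
    have h3 : ∑ m, Q i m * Q j m = (1 : Matrix (Fin n) (Fin n) ℝ) i j := by
      rw [← h1, Matrix.mul_apply]; rfl
    have h4 (k : Fin n) : ∑ m, xi l k k * (uvec Q k m i * uvec Q k m j) =
        Real.exp (l k) * (Q i k * Q j k) * (1 : Matrix (Fin n) (Fin n) ℝ) i j := by
      rw [← h3, Finset.mul_sum]
      refine Finset.sum_congr rfl fun m _ => ?_
      rw [xi_self]
      simp only [uvec]
      ring
    simp_rw [h4, ← Finset.sum_mul]
    by_cases hij : i = j
    · subst hij
      simp [sq]
    · simp [hij]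
  have h5 : ∑ k, ∑ m, xi l m m * (uvec Q k m i * uvec Q k m j) =
      diagonal (fun i => ∑ k, Real.exp (l k) * Q i k ^ 2) i j := by
    rw [← h2, Finset.sum_comm]
    exact Finset.sum_congr rfl fun m _ => Finset.sum_congr rfl fun k _ => by rw [uvec_symm Q]
  have h6 := two_mul_sum_Ioi (fun k m => phi l k m * (uvec Q k m i * uvec Q k m j))
    (fun k m => by rw [phi_symm, uvec_symm]) (fun k => by rw [phi_self, zero_mul])
  have h7 : ∑ k, ∑ m, phi l k m * (uvec Q k m i * uvec Q k m j) =
      2 * (diagonal (fun i => ∑ k, Real.exp (l k) * Q i k ^ 2) i j -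
        ∑ k, ∑ m, xi l k m * (uvec Q k m i * uvec Q k m j)) := by
    have h8 : ∑ k, ∑ m, 2 * xi l k m * (uvec Q k m i * uvec Q k m j) =
        2 * ∑ k, ∑ m, xi l k m * (uvec Q k m i * uvec Q k m j) := by
      simp_rw [Finset.mul_sum, mul_assoc]
    simp only [phi, sub_mul, add_mul, Finset.sum_sub_distrib, Finset.sum_add_distrib, h2, h5, h8]
    ring
  simp only [gapMatrix, deltaJac, Matrix.sub_apply, Matrix.sum_apply, Matrix.smul_apply,
    Matrix.vecMulVec_apply, smul_eq_mul]
  linarith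

theorem jTilde_eq (Q : Matrix (Fin n) (Fin n) ℝ) (l d : Fin n → ℝ) :
    jTilde Q l d = invSqrtD d * gapMatrix Q l * invSqrtD d := by
  simp only [jTilde, gapMatrix, Matrix.mul_sum, Matrix.sum_mul, Matrix.mul_smul, Matrix.smul_mul]

theorem invSqrtD_mul_jTilde_mul_sqrtD (Q : Matrix (Fin n) (Fin n) ℝ) (l : Fin n → ℝ) {d : Fin n → ℝ}
    (hd : ∀ i, 0 < d i) :
    invSqrtD d * jTilde Q l d * sqrtD d = diagonal (fun i => (d i)⁻¹) * gapMatrix Q l := by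
  rw [jTilde_eq]
  ext i j
  have hj := (Real.sqrt_pos.2 (hd j)).ne'
  simp only [invSqrtD, sqrtD, Matrix.mul_diagonal, Matrix.diagonal_mul]
  generalize gapMatrix Q l i j = c
  calc (√(d i))⁻¹ * ((√(d i))⁻¹ * c * (√(d j))⁻¹) * √(d j)
      = (√(d i) * √(d i))⁻¹ * c * ((√(d j))⁻¹ * √(d j)) := by rw [mul_inv]; ring
    _ = _ := by rw [inv_mul_cancel₀ hj, mul_one, Real.mul_self_sqrt (hd i).le]

theorem gapMatrix_posSemidef (Q : Matrix (Fin n) (Fin n) ℝ) (l : Fin n → ℝ) :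
    (gapMatrix Q l).PosSemidef := by
  refine Matrix.posSemidef_sum _ fun k _ => Matrix.posSemidef_sum _ fun m _ =>
    Matrix.PosSemidef.smul ?_ (phi_nonneg l k m)
  simpa using Matrix.posSemidef_vecMulVec_self_star (uvec Q k m)

theorem jTilde_posSemidef (Q : Matrix (Fin n) (Fin n) ℝ) (l d : Fin n → ℝ) :
    (jTilde Q l d).PosSemidef := by
  rw [jTilde_eq]
  have h := (gapMatrix_posSemidef Q l).mul_mul_conjTranspose_same (invSqrtD d)
  have h2 : (invSqrtD d)ᴴ = invSqrtD d := by
    simp [invSqrtD]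
  rwa [h2] at h

theorem delta_pos {A : Matrix (Fin n) (Fin n) ℝ} (hA : A.IsSymm) (x : Fin n → ℝ) (i : Fin n) :
    0 < delta A x i := by
  obtain ⟨Q, hQ, l, h⟩ := exists_spectral_decomposition (withDiag_isSymm hA x)
  have h1 : Q * Qᵀ = 1 := (Matrix.mem_orthogonalGroup_iff (Fin n) ℝ).1 hQ
  have h3 : ∑ m, Q i m * Q i m = 1 := by
    have := congrFun (congrFun h1 i) i
    rw [Matrix.mul_apply, Matrix.one_apply_eq] at this
    exact this
  rw [delta_eq hQ h]
  refine Finset.sum_pos' (fun k _ => by positivity) ?_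
  by_contra! hc
  have : ∑ m, Q i m * Q i m = 0 := Finset.sum_eq_zero fun m _ => by
    have := hc m (Finset.mem_univ _)
    have h4 : Q i m ^ 2 ≤ 0 := nonpos_of_mul_nonpos_right this (Real.exp_pos _)
    nlinarith [sq_nonneg (Q i m)]
  linarith

theorem dotProduct_deltaJac_mulVec (Q : Matrix (Fin n) (Fin n) ℝ) (l v : Fin n → ℝ) :
    v ⬝ᵥ deltaJac Q l *ᵥ v = ∑ k, ∑ m, xi l k m * (uvec Q k m ⬝ᵥ v) ^ 2 := by
  simp only [deltaJac, Matrix.sum_mulVec, Matrix.smul_mulVec, Matrix.vecMulVec_mulVec,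
    dotProduct_sum, dotProduct_smul]
  refine Finset.sum_congr rfl fun k _ => Finset.sum_congr rfl fun m _ => ?_
  simp only [smul_eq_mul, MulOpposite.smul_eq_mul_unop, MulOpposite.unop_op,
    dotProduct_comm v]
  ring

/-- The quadratic form of `H` at `v` is `∑ ξ_{km} (u_{km} ⬝ v)²`, and the numbers `u_{km} ⬝ v` are the
entries of `Qᵀ diag(v) Q`, which vanish together only for `v = 0`. -/
theorem dotProduct_deltaJac_mulVec_pos {Q : Matrix (Fin n) (Fin n) ℝ}
    (hQ : Q ∈ Matrix.orthogonalGroup (Fin n) ℝ) (l : Fin n → ℝ) {v : Fin n → ℝ} (hv : v ≠ 0) :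
    0 < v ⬝ᵥ deltaJac Q l *ᵥ v := by
  have h1 : Q * Qᵀ = 1 := (Matrix.mem_orthogonalGroup_iff (Fin n) ℝ).1 hQ
  rw [dotProduct_deltaJac_mulVec]
  have hn (k m : Fin n) : 0 ≤ xi l k m * (uvec Q k m ⬝ᵥ v) ^ 2 :=
    mul_nonneg (xi_pos l k m).le (sq_nonneg _)
  refine lt_of_le_of_ne (Finset.sum_nonneg fun k _ => Finset.sum_nonneg fun m _ => hn k m) ?_
  intro h0
  apply hv
  have hz (k m : Fin n) : uvec Q k m ⬝ᵥ v = 0 := by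
    have h2 := (Finset.sum_eq_zero_iff_of_nonneg
      (fun k _ => Finset.sum_nonneg fun m _ => hn k m)).1 h0.symm k (Finset.mem_univ _)
    have h3 := (Finset.sum_eq_zero_iff_of_nonneg (fun m _ => hn k m)).1 h2 m (Finset.mem_univ _)
    simpa [(xi_pos l k m).ne'] using h3
  have hT : Qᵀ * diagonal v * Q = 0 := by
    ext k m
    rw [Matrix.mul_apply, Matrix.zero_apply, ← hz k m]
    refine Finset.sum_congr rfl fun j _ => ?_
    rw [Matrix.mul_diagonal, Matrix.transpose_apply, uvec]
    ring
  have hD : diagonal v = 0 := by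
    calc diagonal v = (Q * Qᵀ) * diagonal v * (Q * Qᵀ) := by simp [h1]
      _ = Q * (Qᵀ * diagonal v * Q) * Qᵀ := by simp only [Matrix.mul_assoc]
      _ = 0 := by simp [hT]
  exact Matrix.diagonal_eq_zero.1 hD

theorem hasStrictFDerivAt_g {A : Matrix (Fin n) (Fin n) ℝ} (hA : A.IsSymm) {x : Fin n → ℝ}
    {Q : Matrix (Fin n) (Fin n) ℝ} {l : Fin n → ℝ}
    (hQ : Q ∈ Matrix.orthogonalGroup (Fin n) ℝ) (h : withDiag A x = Q * diagonal l * Qᵀ) :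
    HasStrictFDerivAt (g A) (LinearMap.toContinuousLinearMap
      (Matrix.toLin' (diagonal (fun i => (delta A x i)⁻¹) * gapMatrix Q l))) x := by
  have hg : gapMatrix Q l = diagonal (delta A x) - deltaJac Q l := by
    rw [gapMatrix_eq hQ l, ← funext (delta_eq hQ h)]
  refine hasStrictFDerivAt_pi'.2 fun i => ?_
  have h1 := hasStrictFDerivAt_pi'.1 (hasStrictFDerivAt_delta_of_eq hQ h) i
  have h2 := (hasStrictFDerivAt_apply (𝕜 := ℝ) i x).sub (h1.log (delta_pos hA x i).ne')
  refine h2.congr_fderiv ?_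
  refine ContinuousLinearMap.ext fun v => ?_
  change v i - (delta A x i)⁻¹ * (deltaJac Q l *ᵥ v) i =
    ((diagonal (fun i => (delta A x i)⁻¹) * gapMatrix Q l) *ᵥ v) i
  rw [← Matrix.mulVec_mulVec, Matrix.mulVec_diagonal, hg, Matrix.sub_mulVec, Pi.sub_apply,
    Matrix.mulVec_diagonal]
  have := (delta_pos hA x i).ne'
  field_simp

/-! ### Local contraction and the spectrum of the Jacobian matrix -/

/-- If the strict derivative of `f` at `x` decreases the norm `N` of every nonzero vector, then `f` is
a contraction for `N` near `x`. By compactness of the unit sphere the decrease is at least `m ‖v‖`,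
which absorbs the error of the linear approximation. -/
theorem exists_contracting_nhds {E : Type*} [NormedAddCommGroup E] [NormedSpace ℝ E]
    [FiniteDimensional ℝ E] (N : Seminorm ℝ E) (hc : Continuous N) {f : E → E} {f' : E →L[ℝ] E}
    {x : E} (hf : HasStrictFDerivAt f f' x) (hN : ∀ v, v ≠ 0 → N (f' v) < N v) :
    ∃ L : ℝ, 0 ≤ L ∧ L < 1 ∧ ∃ U ∈ 𝓝 x, ∀ y ∈ U, ∀ z ∈ U, N (f y - f z) ≤ L * N (y - z) := by
  obtain ⟨K, hK, hNK⟩ := Seminorm.bound_of_continuous_normedSpace N hc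
  obtain ⟨m, hm, hmN⟩ : ∃ m > 0, ∀ v, m * ‖v‖ ≤ N v - N (f' v) := by
    have hcont : Continuous fun v => N v - N (f' v) := by fun_prop
    obtain ⟨m, hm, h⟩ : ∃ m > 0, ∀ v ∈ Metric.sphere (0 : E) 1, m ≤ N v - N (f' v) := by
      rcases (Metric.sphere (0 : E) 1).eq_empty_or_nonempty with he | hne
      · exact ⟨1, one_pos, by simp [he]⟩
      · obtain ⟨w, hw, hmin⟩ := (isCompact_sphere (0 : E) 1).exists_isMinOn hne hcont.continuousOn
        have hw0 : w ≠ 0 := by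
          rintro rfl
          simp at hw
        exact ⟨_, sub_pos.2 (hN w hw0), fun v hv => hmin hv⟩
    refine ⟨m, hm, fun v => ?_⟩
    by_cases hv : v = 0
    · simp [hv]
    · have hv' : 0 < ‖v‖ := norm_pos_iff.2 hv
      have h1 := h (‖v‖⁻¹ • v) (by simp [norm_smul, hv'.ne'])
      rw [_root_.map_smul f', map_smul_eq_mul, map_smul_eq_mul, norm_inv, norm_norm, ← mul_sub] at h1
      rwa [le_inv_mul_iff₀ hv', mul_comm] at h1
  have h1 := hf.isLittleO.def (c := m / (2 * K)) (by positivity)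
  rw [nhds_prod_eq, Filter.eventually_prod_self_iff'] at h1
  obtain ⟨U, hU, h2⟩ := h1
  refine ⟨max 0 (1 - m / (2 * K)), le_max_left _ _, max_lt one_pos (by
    have : 0 < m / (2 * K) := by positivity
    linarith), U, hU, fun y hy z hz => ?_⟩
  have h3 : N (f y - f z) ≤ N (f' (y - z)) + N (f y - f z - f' (y - z)) := by
    simpa using map_add_le_add N (f' (y - z)) (f y - f z - f' (y - z))
  have h4 : N (f y - f z - f' (y - z)) ≤ m / 2 * ‖y - z‖ := by
    calc _ ≤ K * ‖f y - f z - f' (y - z)‖ := hNK _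
      _ ≤ K * (m / (2 * K) * ‖y - z‖) := by gcongr; exact h2 y hy z hz
      _ = _ := by field_simp
  have h5 := hmN (y - z)
  have h6 : m / (2 * K) * N (y - z) ≤ m / 2 * ‖y - z‖ := by
    calc _ ≤ m / (2 * K) * (K * ‖y - z‖) := by gcongr; exact hNK _
      _ = _ := by field_simp
  calc N (f y - f z) ≤ (1 - m / (2 * K)) * N (y - z) := by linarith
    _ ≤ _ := by gcongr; exact le_max_right _ _

/-- The weighted Euclidean seminorm `(∑ i, d_i v_i²)^{1/2}`, for `d ≥ 0`. -/
def weightedSeminorm (d : Fin n → ℝ) : Seminorm ℝ (Fin n → ℝ) :=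
  (normSeminorm ℝ (EuclideanSpace ℝ (Fin n))).comp
    ((WithLp.linearEquiv 2 ℝ (Fin n → ℝ)).symm.toLinearMap ∘ₗ
      Matrix.toLin' (diagonal fun i => √(d i)))

theorem weightedSeminorm_apply {d : Fin n → ℝ} (hd : ∀ i, 0 ≤ d i) (v : Fin n → ℝ) :
    weightedSeminorm d v = √(∑ i, d i * v i ^ 2) := by
  have : weightedSeminorm d v = ‖WithLp.toLp 2 (diagonal (fun i => √(d i)) *ᵥ v)‖ := rfl
  rw [this, EuclideanSpace.norm_eq]
  congr 1
  refine Finset.sum_congr rfl fun i _ => ?_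
  rw [PiLp.toLp_apply, Matrix.mulVec_diagonal, Real.norm_eq_abs, sq_abs, mul_pow, Real.sq_sqrt (hd i)]

theorem continuous_weightedSeminorm {d : Fin n → ℝ} (hd : ∀ i, 0 ≤ d i) :
    Continuous (weightedSeminorm d) := by
  rw [show ⇑(weightedSeminorm d) = fun v => √(∑ i, d i * v i ^ 2) from
    funext (weightedSeminorm_apply hd)]
  fun_prop

theorem mulVec_diagonal_inv_mul (G : Matrix (Fin n) (Fin n) ℝ) {d : Fin n → ℝ}
    (hd : ∀ i, 0 < d i) (v : Fin n → ℝ) (i : Fin n) :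
    d i * ((diagonal (fun i => (d i)⁻¹) * G) *ᵥ v) i = (G *ᵥ v) i := by
  rw [← Matrix.mulVec_mulVec, Matrix.mulVec_diagonal, mul_inv_cancel_left₀ (hd i).ne']

theorem dotProduct_mulVec_comm_of_posSemidef {G : Matrix (Fin n) (Fin n) ℝ} (hG : G.PosSemidef)
    (v w : Fin n → ℝ) : v ⬝ᵥ G *ᵥ w = w ⬝ᵥ G *ᵥ v := by
  have : Gᵀ = G := by
    rw [← Matrix.conjTranspose_eq_transpose_of_trivial]; exact hG.1
  rw [Matrix.dotProduct_mulVec, ← Matrix.mulVec_transpose, this, dotProduct_comm]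

/-- If `0 ≤ G ≤ D` as quadratic forms, then `G D⁻¹ G ≤ G`; the left side below is the form of
`G D⁻¹ G`. With `w = D⁻¹ G v`, expand `(v - w)ᵀ G (v - w) ≥ 0` and use `wᵀ G w ≤ wᵀ D w`. -/
theorem sum_mul_sq_mulVec_le {G : Matrix (Fin n) (Fin n) ℝ} (hG : G.PosSemidef) {d : Fin n → ℝ}
    (hd : ∀ i, 0 < d i) (hle : ∀ v, v ⬝ᵥ G *ᵥ v ≤ ∑ i, d i * v i ^ 2) (v : Fin n → ℝ) :
    ∑ i, d i * ((diagonal (fun i => (d i)⁻¹) * G) *ᵥ v) i ^ 2 ≤ v ⬝ᵥ G *ᵥ v := by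
  have hw := mulVec_diagonal_inv_mul G hd v
  set w := (diagonal (fun i => (d i)⁻¹) * G) *ᵥ v
  have h1 : ∑ i, d i * w i ^ 2 = w ⬝ᵥ G *ᵥ v :=
    Finset.sum_congr rfl fun i _ => by rw [← hw i]; ring
  have h2 := hG.dotProduct_mulVec_nonneg (v - w)
  have h3 := hle w
  have h4 := dotProduct_mulVec_comm_of_posSemidef hG v w
  have h5 : w ⬝ᵥ G *ᵥ v = ∑ i, d i * w i ^ 2 := h1.symm
  simp only [star_trivial, Matrix.mulVec_sub, dotProduct_sub, sub_dotProduct] at h2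
  linarith

/-- If `0 ≤ G < D` as quadratic forms, then the complex eigenvalues of `D⁻¹ G` are real and lie in
`[0, 1)`: split an eigenvector into its real part `a` and imaginary part `b`; symmetry of `G` forces
`Im μ = 0`, and then `μ` is a quotient of the forms of `G` and `D`. -/
theorem spectrum_diagonal_inv_mul {G : Matrix (Fin n) (Fin n) ℝ} (hG : G.PosSemidef) {d : Fin n → ℝ}
    (hd : ∀ i, 0 < d i) (hlt : ∀ v, v ≠ 0 → v ⬝ᵥ G *ᵥ v < ∑ i, d i * v i ^ 2) {μ : ℂ}
    (hμ : μ ∈ spectrum ℂ ((diagonal (fun i => (d i)⁻¹) * G).map (algebraMap ℝ ℂ))) :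
    ∃ r : ℝ, 0 ≤ r ∧ r < 1 ∧ μ = (r : ℂ) := by
  have hw := mulVec_diagonal_inv_mul G hd
  set J := diagonal (fun i => (d i)⁻¹) * G
  obtain ⟨w, hw0, hJw⟩ : ∃ w : Fin n → ℂ, w ≠ 0 ∧ J.map (algebraMap ℝ ℂ) *ᵥ w = μ • w := by
    rw [spectrum.mem_iff, Matrix.isUnit_iff_isUnit_det, isUnit_iff_ne_zero, not_not] at hμ
    obtain ⟨w, hw0, h⟩ := Matrix.exists_mulVec_eq_zero_iff.2 hμ
    refine ⟨w, hw0, ?_⟩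
    rw [Matrix.sub_mulVec, sub_eq_zero, Algebra.algebraMap_eq_smul_one, Matrix.smul_mulVec,
      Matrix.one_mulVec] at h
    exact h.symm
  set a : Fin n → ℝ := fun i => (w i).re with ha
  set b : Fin n → ℝ := fun i => (w i).im with hb
  have hre (i : Fin n) : (J *ᵥ a) i = μ.re * a i - μ.im * b i := by
    have := congrArg Complex.re (congrFun hJw i)
    simpa [Matrix.mulVec, dotProduct, Complex.re_sum] using this
  have him (i : Fin n) : (J *ᵥ b) i = μ.re * b i + μ.im * a i := by
    have := congrArg Complex.im (congrFun hJw i)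
    simpa [Matrix.mulVec, dotProduct, Complex.im_sum] using this
  have hab : a ≠ 0 ∨ b ≠ 0 := by
    by_contra! h
    apply hw0
    ext i
    exact Complex.ext (congrFun h.1 i) (congrFun h.2 i)
  have hGa (v : Fin n → ℝ) : v ⬝ᵥ G *ᵥ a =
      μ.re * ∑ i, d i * (v i * a i) - μ.im * ∑ i, d i * (v i * b i) := by
    rw [Finset.mul_sum, Finset.mul_sum, ← Finset.sum_sub_distrib]
    exact Finset.sum_congr rfl fun i _ => by rw [← hw a i, hre]; ring
  have hGb (v : Fin n → ℝ) : v ⬝ᵥ G *ᵥ b =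
      μ.re * ∑ i, d i * (v i * b i) + μ.im * ∑ i, d i * (v i * a i) := by
    rw [Finset.mul_sum, Finset.mul_sum, ← Finset.sum_add_distrib]
    exact Finset.sum_congr rfl fun i _ => by rw [← hw b i, him]; ring
  have hpos (v : Fin n → ℝ) (hv : v ≠ 0) : 0 < ∑ i, d i * (v i * v i) := by
    refine (hG.dotProduct_mulVec_nonneg v).trans_lt ?_
    simpa [sq] using hlt v hv
  have hnn (v : Fin n → ℝ) : 0 ≤ ∑ i, d i * (v i * v i) :=
    Finset.sum_nonneg fun i _ => mul_nonneg (hd i).le (mul_self_nonneg _)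
  have hsymm := dotProduct_mulVec_comm_of_posSemidef hG a b
  have hcomm : ∑ i, d i * (a i * b i) = ∑ i, d i * (b i * a i) := by simp_rw [mul_comm (a _)]
  have h0 : μ.im = 0 := by
    rw [hGa, hGb, hcomm] at hsymm
    have h1 : μ.im * (∑ i, d i * (a i * a i) + ∑ i, d i * (b i * b i)) = 0 := by linarith
    refine (mul_eq_zero.1 h1).resolve_right ?_
    rcases hab with h | h
    · linarith [hpos a h, hnn b]
    · linarith [hpos b h, hnn a]
  have hfin (v : Fin n → ℝ) (hv : v ≠ 0) (h : v ⬝ᵥ G *ᵥ v = μ.re * ∑ i, d i * (v i * v i)) :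
      0 ≤ μ.re ∧ μ.re < 1 := by
    have h1 := hpos v hv
    have h2 : 0 ≤ v ⬝ᵥ G *ᵥ v := hG.dotProduct_mulVec_nonneg v
    have h3 := hlt v hv
    simp only [sq] at h3
    rw [h] at h2 h3
    exact ⟨nonneg_of_mul_nonneg_left h2 h1, by nlinarith⟩
  have hr : 0 ≤ μ.re ∧ μ.re < 1 := by
    rcases hab with h | h
    · exact hfin a h (by rw [hGa, h0]; ring)
    · exact hfin b h (by rw [hGb, h0]; ring)
  exact ⟨μ.re, hr.1, hr.2, Complex.ext rfl (by simpa using h0)⟩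

theorem dotProduct_gapMatrix_mulVec_lt {A : Matrix (Fin n) (Fin n) ℝ} {x : Fin n → ℝ}
    {Q : Matrix (Fin n) (Fin n) ℝ} {l : Fin n → ℝ}
    (hQ : Q ∈ Matrix.orthogonalGroup (Fin n) ℝ) (h : withDiag A x = Q * diagonal l * Qᵀ)
    (v : Fin n → ℝ) (hv : v ≠ 0) :
    v ⬝ᵥ gapMatrix Q l *ᵥ v < ∑ i, delta A x i * v i ^ 2 := by
  rw [gapMatrix_eq hQ l, ← funext (delta_eq hQ h), Matrix.sub_mulVec, dotProduct_sub]
  have h1 := dotProduct_deltaJac_mulVec_pos hQ l hv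
  have h2 : v ⬝ᵥ diagonal (delta A x) *ᵥ v = ∑ i, delta A x i * v i ^ 2 :=
    Finset.sum_congr rfl fun i _ => by rw [Matrix.mulVec_diagonal]; ring
  linarith

theorem g_locally_contracting {A : Matrix (Fin n) (Fin n) ℝ} (hA : A.IsSymm) (x : Fin n → ℝ) :
    ∃ L : ℝ, 0 ≤ L ∧ L < 1 ∧ ∃ U ∈ 𝓝 x, ∀ y ∈ U, ∀ z ∈ U,
      weightedSeminorm (delta A x) (g A y - g A z) ≤ L * weightedSeminorm (delta A x) (y - z) := by
  obtain ⟨Q, hQ, l, h⟩ := exists_spectral_decomposition (withDiag_isSymm hA x)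
  have hd := delta_pos hA x
  refine exists_contracting_nhds _ (continuous_weightedSeminorm fun i => (hd i).le)
    (hasStrictFDerivAt_g hA hQ h) fun v hv => ?_
  have hle (w : Fin n → ℝ) : w ⬝ᵥ gapMatrix Q l *ᵥ w ≤ ∑ i, delta A x i * w i ^ 2 := by
    by_cases hw : w = 0
    · simp [hw]
    · exact (dotProduct_gapMatrix_mulVec_lt hQ h w hw).le
  rw [weightedSeminorm_apply fun i => (hd i).le, weightedSeminorm_apply fun i => (hd i).le]
  exact Real.sqrt_lt_sqrt (Finset.sum_nonneg fun i _ => mul_nonneg (hd i).le (sq_nonneg _))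
    ((sum_mul_sq_mulVec_le (gapMatrix_posSemidef Q l) hd hle v).trans_lt
      (dotProduct_gapMatrix_mulVec_lt hQ h v hv))

end Gap

/-! ### The Lie product formula -/

section LieProduct
open NormedSpace Filter

theorem norm_exp_le_exp_norm {𝔸 : Type*} [NormedRing 𝔸] [NormOneClass 𝔸] [NormedAlgebra ℝ 𝔸]
    (x : 𝔸) : ‖exp x‖ ≤ Real.exp ‖x‖ := by
  have hle (k : ℕ) : ‖((k.factorial : ℝ)⁻¹) • x ^ k‖ ≤ ‖x‖ ^ k / k.factorial := by
    rw [norm_smul, norm_inv, Real.norm_natCast, div_eq_inv_mul]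
    gcongr
    exact norm_pow_le x k
  rw [exp_eq_tsum ℝ, Real.exp_eq_exp_ℝ, exp_eq_tsum_div]
  exact tsum_of_norm_bounded (Real.summable_pow_div_factorial ‖x‖).hasSum hle

theorem norm_pow_sub_pow_le {𝔸 : Type*} [NormedRing 𝔸] [NormOneClass 𝔸] {X Y : 𝔸} {a : ℝ}
    (ha : 1 ≤ a) (hX : ‖X‖ ≤ a) (hY : ‖Y‖ ≤ a) (N : ℕ) :
    ‖X ^ N - Y ^ N‖ ≤ N * a ^ N * ‖X - Y‖ := by
  induction N with
  | zero => simp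
  | succ N ih =>
    have e : X ^ (N + 1) - Y ^ (N + 1) = X ^ N * (X - Y) + (X ^ N - Y ^ N) * Y := by
      rw [pow_succ, pow_succ]; noncomm_ring
    have h1 : ‖X ^ N * (X - Y)‖ ≤ a ^ (N + 1) * ‖X - Y‖ := by
      calc _ ≤ ‖X ^ N‖ * ‖X - Y‖ := norm_mul_le _ _
        _ ≤ a ^ N * ‖X - Y‖ := by
          gcongr
          exact (norm_pow_le X N).trans (by gcongr)
        _ ≤ _ := by gcongr; omega
    have h2 : ‖(X ^ N - Y ^ N) * Y‖ ≤ N * a ^ N * ‖X - Y‖ * a :=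
      (norm_mul_le _ _).trans (by gcongr)
    rw [e]
    refine (norm_add_le _ _).trans ((add_le_add h1 h2).trans (le_of_eq ?_))
    push_cast
    ring

/-- The Lie product formula. -/
theorem tendsto_exp_mul_exp_pow {𝔸 : Type*} [NormedRing 𝔸] [NormOneClass 𝔸] [NormedAlgebra ℝ 𝔸]
    [CompleteSpace 𝔸] (B C : 𝔸) :
    Tendsto (fun N : ℕ => (exp ((N : ℝ)⁻¹ • B) * exp ((N : ℝ)⁻¹ • C)) ^ N) atTop
      (𝓝 (exp (B + C))) := by
  let : NormedAlgebra ℚ 𝔸 := NormedAlgebra.restrictScalars ℚ ℝ 𝔸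
  -- `φ` vanishes to first order at `0`, so `N ‖φ (1 / N)‖ → 0`; taking `N`-th powers multiplies the
  -- error by at most `N` times a constant.
  set φ : ℝ → 𝔸 := fun t => exp (t • B) * exp (t • C) - exp (t • (B + C)) with hφ
  have hφ0 : φ 0 = 0 := by simp [hφ]
  have hd : HasDerivAt φ 0 0 := by
    have h := ((hasDerivAt_exp_smul_const B (0 : ℝ)).mul (hasDerivAt_exp_smul_const C (0 : ℝ))).sub
      (hasDerivAt_exp_smul_const (B + C) (0 : ℝ))
    simp only [zero_smul, exp_zero, one_mul, mul_one, sub_self] at h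
    exact h
  have hinv : Tendsto (fun N : ℕ => ((N : ℝ))⁻¹) atTop (𝓝 0) := tendsto_inv_atTop_nhds_zero_nat
  have ho : Tendsto (fun N : ℕ => (N : ℝ) * ‖φ ((N : ℝ)⁻¹)‖) atTop (𝓝 0) := by
    have h1 := (hasDerivAt_iff_isLittleO_nhds_zero.1 hd).comp_tendsto hinv
    simp only [Function.comp_def, zero_add, hφ0, sub_zero, smul_zero] at h1
    refine h1.norm_left.tendsto_div_nhds_zero.congr fun N => ?_
    rw [div_inv_eq_mul, mul_comm]
  rw [tendsto_iff_norm_sub_tendsto_zero]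
  have ho' := ho.const_mul (Real.exp (‖B‖ + ‖C‖))
  rw [mul_zero] at ho'
  refine squeeze_zero' (Eventually.of_forall fun _ => norm_nonneg _) ?_ ho'
  filter_upwards [eventually_gt_atTop 0] with N hN
  have hN' : (N : ℝ) ≠ 0 := by positivity
  have hY : exp (B + C) = exp ((N : ℝ)⁻¹ • (B + C)) ^ N := by
    rw [← NormedSpace.exp_nsmul, ← Nat.cast_smul_eq_nsmul ℝ, smul_smul, mul_inv_cancel₀ hN', one_smul]
  set a := Real.exp ((N : ℝ)⁻¹ * (‖B‖ + ‖C‖)) with ha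
  have ha1 : 1 ≤ a := Real.one_le_exp (by positivity)
  have haN : a ^ N = Real.exp (‖B‖ + ‖C‖) := by
    rw [ha, ← Real.exp_nat_mul, mul_inv_cancel_left₀ hN']
  have hnorm (x : 𝔸) : ‖(N : ℝ)⁻¹ • x‖ = (N : ℝ)⁻¹ * ‖x‖ := by
    rw [norm_smul, norm_inv, Real.norm_natCast]
  have h1 : ‖exp ((N : ℝ)⁻¹ • B) * exp ((N : ℝ)⁻¹ • C)‖ ≤ a := by
    refine (norm_mul_le _ _).trans ?_
    rw [ha, mul_add, Real.exp_add, ← hnorm B, ← hnorm C]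
    gcongr <;> exact norm_exp_le_exp_norm _
  have h2 : ‖exp ((N : ℝ)⁻¹ • (B + C))‖ ≤ a := by
    refine (norm_exp_le_exp_norm _).trans (Real.exp_le_exp.2 ?_)
    rw [hnorm]
    gcongr
    exact norm_add_le B C
  rw [hY]
  refine (norm_pow_sub_pow_le ha1 h1 h2 N).trans (le_of_eq ?_)
  rw [haN]
  ring

end LieProduct

/-! ### The Golden–Thompson inequality -/

section GoldenThompson
theorem trace_mul_transpose_self_nonneg {ι : Type*} [Fintype ι] (X : Matrix ι ι ℝ) : 0 ≤ (X * Xᵀ).trace :=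
  Finset.sum_nonneg fun i _ => Finset.sum_nonneg fun j _ => mul_self_nonneg (X i j)

variable {ι : Type*} [Fintype ι] [DecidableEq ι]

theorem trace_mul_pow_comm (X Y : Matrix ι ι ℝ) (m : ℕ) :
    ((X * Y) ^ m).trace = ((Y * X) ^ m).trace := by
  cases m with
  | zero => simp
  | succ m =>
    rw [pow_succ, ← Matrix.mul_assoc, mul_pow_mul, Matrix.trace_mul_comm, ← Matrix.mul_assoc,
      ← pow_succ']

/-- Two trace inequalities that carry each other through the induction on `k`: the first at `k`
with `M = X Y` reduces the second at `k + 1` to the second at `k` for `X ^ 2`, `Y ^ 2`; and both at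
`k` give the first at `k + 1`, by applying them to `M ^ 2` and to the pair `M Mᵀ`, `Mᵀ M`. -/
theorem trace_pow_two_pow_le (k : ℕ) :
    (∀ M : Matrix ι ι ℝ, (M ^ 2 ^ (k + 1)).trace ≤ ((M * Mᵀ) ^ 2 ^ k).trace) ∧
    (∀ X Y : Matrix ι ι ℝ, X.IsSymm → Y.IsSymm →
      ((X * Y) ^ 2 ^ k).trace ≤ (X ^ 2 ^ k * Y ^ 2 ^ k).trace) := by
  induction k with
  | zero =>
    refine ⟨fun M => ?_, fun X Y _ _ => by simp⟩
    have h := trace_mul_transpose_self_nonneg (M - Mᵀ)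
    have h1 : (Mᵀ * Mᵀ).trace = (M * M).trace := by
      rw [← Matrix.transpose_mul, Matrix.trace_transpose]
    rw [Matrix.transpose_sub, Matrix.transpose_transpose, Matrix.sub_mul, Matrix.mul_sub,
      Matrix.mul_sub, Matrix.trace_sub, Matrix.trace_sub, Matrix.trace_sub, h1,
      Matrix.trace_mul_comm Mᵀ M] at h
    simp only [zero_add, pow_one, pow_zero, sq]
    linarith
  | succ k ih =>
    obtain ⟨hW, hG⟩ := ih
    have h2 : 2 ^ (k + 1) = 2 * 2 ^ k := by ring
    refine ⟨fun M => ?_, fun X Y hX hY => ?_⟩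
    · have hP : (Mᵀ * M).IsSymm := by simp [Matrix.IsSymm, Matrix.transpose_mul]
      have hQ : (M * Mᵀ).IsSymm := by simp [Matrix.IsSymm, Matrix.transpose_mul]
      have hPk : ((Mᵀ * M) ^ 2 ^ k).IsSymm := by
        rw [Matrix.IsSymm, Matrix.transpose_pow, hP.eq]
      have hQk : ((M * Mᵀ) ^ 2 ^ k).IsSymm := by
        rw [Matrix.IsSymm, Matrix.transpose_pow, hQ.eq]
      have h3 : (M ^ 2 * (M ^ 2)ᵀ) = M * (M * Mᵀ * Mᵀ) := by
        rw [Matrix.transpose_pow, sq, sq]; simp only [Matrix.mul_assoc]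
      have h4 : M * Mᵀ * Mᵀ * M = M * Mᵀ * (Mᵀ * M) := by simp only [Matrix.mul_assoc]
      have h5 := trace_mul_transpose_self_nonneg ((Mᵀ * M) ^ 2 ^ k - (M * Mᵀ) ^ 2 ^ k)
      rw [Matrix.transpose_sub, hPk.eq, hQk.eq, Matrix.sub_mul, Matrix.mul_sub,
        Matrix.mul_sub, Matrix.trace_sub, Matrix.trace_sub, Matrix.trace_sub, ← pow_add, ← pow_add,
        ← two_mul, ← h2, trace_mul_pow_comm Mᵀ M, Matrix.trace_mul_comm ((Mᵀ * M) ^ 2 ^ k)] at h5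
      calc (M ^ 2 ^ (k + 1 + 1)).trace = ((M ^ 2) ^ 2 ^ (k + 1)).trace := by
            rw [← pow_mul, ← pow_succ']
        _ ≤ ((M ^ 2 * (M ^ 2)ᵀ) ^ 2 ^ k).trace := hW _
        _ = ((M * Mᵀ * (Mᵀ * M)) ^ 2 ^ k).trace := by rw [h3, trace_mul_pow_comm, h4]
        _ ≤ ((M * Mᵀ) ^ 2 ^ k * (Mᵀ * M) ^ 2 ^ k).trace := hG _ _ hQ hP
        _ ≤ ((M * Mᵀ) ^ 2 ^ (k + 1)).trace := by linarith
    · have hX2 : (X ^ 2).IsSymm := by rw [Matrix.IsSymm, Matrix.transpose_pow, hX.eq]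
      have hY2 : (Y ^ 2).IsSymm := by rw [Matrix.IsSymm, Matrix.transpose_pow, hY.eq]
      have h3 : X * Y * (X * Y)ᵀ = X * (Y ^ 2 * X) := by
        rw [Matrix.transpose_mul, hX.eq, hY.eq, sq]; simp only [Matrix.mul_assoc]
      have h4 : Y ^ 2 * X * X = Y ^ 2 * X ^ 2 := by rw [Matrix.mul_assoc, ← sq]
      calc ((X * Y) ^ 2 ^ (k + 1)).trace ≤ ((X * Y * (X * Y)ᵀ) ^ 2 ^ k).trace := hW _
        _ = ((X ^ 2 * Y ^ 2) ^ 2 ^ k).trace := by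
          rw [h3, trace_mul_pow_comm, h4, trace_mul_pow_comm]
        _ ≤ ((X ^ 2) ^ 2 ^ k * (Y ^ 2) ^ 2 ^ k).trace := hG _ _ hX2 hY2
        _ = (X ^ 2 ^ (k + 1) * Y ^ 2 ^ (k + 1)).trace := by rw [← pow_mul, ← pow_mul, ← h2]

attribute [local instance] Matrix.linftyOpNormedRing Matrix.linftyOpNormedAlgebra in
/-- The Golden–Thompson inequality for real symmetric matrices. -/
theorem trace_exp_add_le {B C : Matrix ι ι ℝ} (hB : B.IsSymm) (hC : C.IsSymm) :
    (NormedSpace.exp (B + C)).trace ≤ (NormedSpace.exp B * NormedSpace.exp C).trace := by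
  rcases isEmpty_or_nonempty ι with h | h
  · simp [Matrix.trace]
  have hl := (tendsto_exp_mul_exp_pow B C).comp (tendsto_pow_atTop_atTop_of_one_lt one_lt_two)
  have hc : Continuous (Matrix.trace : Matrix ι ι ℝ → ℝ) := continuous_id.matrix_trace
  refine le_of_tendsto' ((hc.tendsto _).comp hl) fun k => ?_
  have hs {M : Matrix ι ι ℝ} (hM : M.IsSymm) (c : ℝ) : (NormedSpace.exp (c • M)).IsSymm :=
    Matrix.IsSymm.exp (by rw [Matrix.IsSymm, Matrix.transpose_smul, hM.eq])
  have hp (M : Matrix ι ι ℝ) :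
      NormedSpace.exp (((2 ^ k : ℕ) : ℝ)⁻¹ • M) ^ 2 ^ k = NormedSpace.exp M := by
    rw [← Matrix.exp_nsmul, ← Nat.cast_smul_eq_nsmul ℝ, smul_smul,
      mul_inv_cancel₀ (by positivity), one_smul]
  refine ((trace_pow_two_pow_le k).2 _ _ (hs hB _) (hs hC _)).trans (le_of_eq ?_)
  rw [hp, hp]

end GoldenThompson

/-! ### A metric from uniform contraction of iterates -/

section Dynamics

open Filter

/-- A bijection that is `1`-Lipschitz, and whose inverse is Lipschitz on bounded sets, is a
homeomorphism and reflects completeness. -/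
theorem continuous_and_complete_of_expanding_equiv {X Y : Type*} [MetricSpace X] [MetricSpace Y]
    (e : X ≃ Y) (h1 : ∀ x x', dist (e x) (e x') ≤ dist x x') (y₀ : Y)
    (h2 : ∀ R : ℝ, ∃ C : ℝ, ∀ x x', dist (e x) y₀ ≤ R → dist (e x') y₀ ≤ R →
      dist x x' ≤ C * dist (e x) (e x')) :
    Continuous e ∧ Continuous e.symm ∧ (CompleteSpace Y → CompleteSpace X) := by
  have hlip : LipschitzWith 1 e := LipschitzWith.of_dist_le_mul fun x x' => by simpa using h1 x x'
  have hsymm : Continuous e.symm := by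
    rw [continuous_iff_continuousAt]
    intro y
    obtain ⟨C, hC⟩ := h2 (dist y y₀ + 1)
    rw [ContinuousAt, tendsto_iff_dist_tendsto_zero]
    have ht : Tendsto (fun z => C * dist z y) (𝓝 y) (𝓝 0) := by
      have : Tendsto (fun z => C * dist z y) (𝓝 y) (𝓝 (C * dist y y)) :=
        Continuous.tendsto (by fun_prop) y
      simpa using this
    refine squeeze_zero' (Eventually.of_forall fun _ => dist_nonneg) ?_ ht
    filter_upwards [Metric.ball_mem_nhds y one_pos] with z hz
    rw [Metric.mem_ball] at hz
    have h3 := hC (e.symm z) (e.symm y) (by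
      rw [e.apply_symm_apply]; linarith [dist_triangle z y y₀]) (by
      rw [e.apply_symm_apply]; linarith)
    simpa using h3
  refine ⟨hlip.continuous, hsymm, fun hY => ?_⟩
  refine Metric.complete_of_cauchySeq_tendsto fun u hu => ?_
  obtain ⟨y, hy⟩ := cauchySeq_tendsto_of_complete (hlip.cauchySeq_comp hu)
  refine ⟨e.symm y, ?_⟩
  have := (hsymm.tendsto y).comp hy
  refine this.congr fun k => ?_
  simp

/-- If all iterates of `f` are Lipschitz on balls with constants `O(L ^ k)`, then `f` is an
`L`-contraction for the metric `⨆ k, L⁻ᵏ ‖f^[k] x - f^[k] y‖`. -/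
theorem exists_metricSpace_contracting {E : Type*} [nE : NormedAddCommGroup E] [cE : CompleteSpace E]
    (f : E → E) {L : ℝ} (hL : 0 < L)
    (h : ∀ R : ℝ, ∃ C : ℝ, ∀ x y, ‖x‖ ≤ R → ‖y‖ ≤ R →
      ∀ k : ℕ, ‖f^[k] x - f^[k] y‖ ≤ C * L ^ k * ‖x - y‖) :
    ∃ d : MetricSpace E,
      d.toUniformSpace.toTopologicalSpace = nE.toMetricSpace.toUniformSpace.toTopologicalSpace ∧
      @CompleteSpace E d.toUniformSpace ∧
      (∀ x y : E, ‖x - y‖ ≤ d.dist x y) ∧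
      (∀ R : ℝ, ∃ C : ℝ, ∀ x y : E, ‖x‖ ≤ R → ‖y‖ ≤ R → d.dist x y ≤ C * ‖x - y‖) ∧
      ∀ x y : E, d.dist (f x) (f y) ≤ L * d.dist x y := by
  set s : E → E → ℕ → ℝ := fun x y k => (L ^ k)⁻¹ * ‖f^[k] x - f^[k] y‖ with hs
  have hbd {R C : ℝ} (hC : ∀ x y, ‖x‖ ≤ R → ‖y‖ ≤ R →
      ∀ k : ℕ, ‖f^[k] x - f^[k] y‖ ≤ C * L ^ k * ‖x - y‖) (x y : E) (hx : ‖x‖ ≤ R) (hy : ‖y‖ ≤ R)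
      (k : ℕ) : s x y k ≤ C * ‖x - y‖ := by
    have hk : 0 < L ^ k := pow_pos hL k
    rw [hs, inv_mul_le_iff₀ hk]
    linarith [hC x y hx hy k]
  have hB (x y : E) : BddAbove (Set.range (s x y)) := by
    obtain ⟨C, hC⟩ := h (max ‖x‖ ‖y‖)
    exact ⟨_, Set.forall_mem_range.2 (hbd hC x y (le_max_left _ _) (le_max_right _ _))⟩
  have hle (x y : E) : ‖x - y‖ ≤ ⨆ k, s x y k := by
    simpa [hs] using le_ciSup (hB x y) 0
  let d : MetricSpace E :=
    { dist := fun x y => ⨆ k, s x y k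
      dist_self := fun x => by simp [hs]
      dist_comm := fun x y => by simp only [hs, norm_sub_rev]
      dist_triangle := fun x y z => by
        refine ciSup_le fun k => ?_
        calc s x z k ≤ s x y k + s y z k := by
              simp only [hs]
              rw [← mul_add]
              gcongr
              exact norm_sub_le_norm_sub_add_norm_sub _ _ _
          _ ≤ _ := add_le_add (le_ciSup (hB x y) k) (le_ciSup (hB y z) k)
      eq_of_dist_eq_zero := fun {x y} hxy => by
        have := hle x y
        rw [hxy] at this
        exact sub_eq_zero.1 (norm_le_zero_iff.1 this) }
  have hloc (R : ℝ) : ∃ C : ℝ, ∀ x y : E, ‖x‖ ≤ R → ‖y‖ ≤ R → d.dist x y ≤ C * ‖x - y‖ := by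
    obtain ⟨C, hC⟩ := h R
    exact ⟨C, fun x y hx hy => ciSup_le (hbd hC x y hx hy)⟩
  obtain ⟨hc, hc', hcompl⟩ := @continuous_and_complete_of_expanding_equiv E E d nE.toMetricSpace
    (Equiv.refl E) (fun x y => (dist_eq_norm x y).trans_le (hle x y)) 0 (fun R => by
      obtain ⟨C, hC⟩ := hloc R
      exact ⟨C, fun x y hx hy => (hC x y ((dist_zero_right x).symm.trans_le hx)
        ((dist_zero_right y).symm.trans_le hy)).trans_eq
          (congrArg (C * ·) (dist_eq_norm x y).symm)⟩)
  refine ⟨d, le_antisymm (continuous_id_iff_le.1 hc) (continuous_id_iff_le.1 hc'),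
    hcompl cE, hle, hloc, fun x y => ciSup_le fun k => ?_⟩
  have h1 : s x y (k + 1) ≤ ⨆ k, s x y k := le_ciSup (hB x y) (k + 1)
  have h2 : s (f x) (f y) k = L * s x y (k + 1) := by
    simp only [hs, Function.iterate_succ_apply, pow_succ]
    field_simp
  rw [h2]
  exact mul_le_mul_of_nonneg_left h1 hL.le

/-- Geometric contraction of the iterates of `f`, uniformly on balls. The coercive function `F`
decreases strictly along orbits except at the fixed point `x₀`, so orbits that start in a ball enter
a given neighbourhood of `x₀` after a bounded number of steps; near `x₀` the map contracts. -/
theorem exists_iterate_contracting {E : Type*} [NormedAddCommGroup E] [NormedSpace ℝ E]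
    [FiniteDimensional ℝ E] {f : E → E} {F : E → ℝ} {x₀ : E} (hf : Continuous f)
    (hflip : ∀ R : ℝ, ∃ C : ℝ, ∀ x y, ‖x‖ ≤ R → ‖y‖ ≤ R → ‖f x - f y‖ ≤ C * ‖x - y‖)
    (hF : Continuous F) (hFn : ∀ x, ‖x‖ ≤ F x) (hx₀ : f x₀ = x₀)
    (hFf : ∀ x, x ≠ x₀ → F (f x) < F x) (N : Seminorm ℝ E) (hN : Continuous N)
    (hnN : ∀ v, ‖v‖ ≤ N v) {L : ℝ} (hL0 : 0 ≤ L) (hL1 : L < 1) {U : Set E} (hU : U ∈ 𝓝 x₀)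
    (hUL : ∀ y ∈ U, ∀ z ∈ U, N (f y - f z) ≤ L * N (y - z)) :
    ∃ L' : ℝ, 0 < L' ∧ L' < 1 ∧ ∀ R : ℝ, ∃ C : ℝ, ∀ x y, ‖x‖ ≤ R → ‖y‖ ≤ R →
      ∀ k : ℕ, ‖f^[k] x - f^[k] y‖ ≤ C * L' ^ k * ‖x - y‖ := by
  have : ProperSpace E := FiniteDimensional.proper ℝ E
  obtain ⟨K, hK, hNK⟩ := Seminorm.bound_of_continuous_normedSpace N hN
  obtain ⟨r, hr, hrU⟩ := Metric.mem_nhds_iff.1 hU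
  -- A ball for `N`, rather than for the norm, because it is mapped into itself.
  set W : Set E := {x | N (x - x₀) < r} with hWdef
  have hWU : W ⊆ U := fun x hx => hrU (by
    rw [Metric.mem_ball, dist_eq_norm]; exact (hnN _).trans_lt hx)
  have hWo : IsOpen W := isOpen_lt (by fun_prop) continuous_const
  have hW (x : E) (hx : x ∈ W) : f x ∈ W := by
    have h1 := hUL x (hWU hx) x₀ (mem_of_mem_nhds hU)
    rw [hx₀] at h1
    have h2 : N (x - x₀) < r := hx
    have h3 := apply_nonneg N (x - x₀)
    change N (f x - x₀) < r
    nlinarith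
  have hWk (k : ℕ) (x : E) (hx : x ∈ W) : f^[k] x ∈ W := by
    induction k with
    | zero => exact hx
    | succ k ih => rw [Function.iterate_succ_apply']; exact hW _ ih
  have hWc (k : ℕ) (x y : E) (hx : x ∈ W) (hy : y ∈ W) :
      N (f^[k] x - f^[k] y) ≤ L ^ k * N (x - y) := by
    induction k with
    | zero => simp
    | succ k ih =>
      rw [Function.iterate_succ_apply', Function.iterate_succ_apply', pow_succ', mul_assoc]
      exact (hUL _ (hWU (hWk k x hx)) _ (hWU (hWk k y hy))).trans (by gcongr)
  have hFle (x : E) : F (f x) ≤ F x := by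
    by_cases hx : x = x₀
    · rw [hx, hx₀]
    · exact (hFf x hx).le
  -- The rate has to be positive, as the constant below contains `L'⁻¹`.
  set L' := max L (1 / 2) with hL'
  have hL'0 : 0 < L' := lt_max_of_lt_right (by norm_num)
  have hL'1 : L' < 1 := max_lt hL1 (by norm_num)
  refine ⟨L', hL'0, hL'1, fun R => ?_⟩
  obtain ⟨M, hM⟩ : ∃ M, ∀ x, ‖x‖ ≤ R → F x ≤ M := by
    obtain ⟨M, hM⟩ := (isCompact_closedBall (0 : E) R).bddAbove_image hF.continuousOn
    exact ⟨M, fun x hx => hM (Set.mem_image_of_mem F (by simpa using hx))⟩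
  have hiter (x : E) (hx : F x ≤ M) (k : ℕ) : F (f^[k] x) ≤ M := by
    induction k with
    | zero => exact hx
    | succ k ih => rw [Function.iterate_succ_apply']; exact (hFle _).trans ih
  have hcomp : IsCompact ({x | F x ≤ M} \ W) := by
    refine ((isCompact_closedBall (0 : E) M).of_isClosed_subset
      (isClosed_le hF continuous_const) fun x hx => ?_).diff hWo
    rw [mem_closedBall_zero_iff]
    exact (hFn x).trans hx
  have hx₀W : x₀ ∈ W := by simpa [hWdef] using hr
  obtain ⟨ε, hε, hεF⟩ := hcomp.exists_forall_le' (f := fun x => F x - F (f x)) (a := 0)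
    (by fun_prop) fun x hx => sub_pos.2 (hFf x fun h => hx.2 (h ▸ hx₀W))
  -- Outside `W` each step lowers `F` by at least `ε`, and `0 ≤ F ≤ M` along the orbit.
  obtain ⟨n₀, hn₀⟩ := exists_nat_gt (M / ε)
  have henter (x : E) (hx : F x ≤ M) : f^[n₀] x ∈ W := by
    by_contra hcon
    have hout (j : ℕ) (hj : j ≤ n₀) : f^[j] x ∉ W := fun hjW => hcon (by
      have := hWk (n₀ - j) _ hjW
      rwa [← Function.iterate_add_apply, Nat.sub_add_cancel hj] at this)
    have hdec (j : ℕ) (hj : j ≤ n₀) : F (f^[j] x) ≤ M - j * ε := by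
      induction j with
      | zero => simpa using hx
      | succ j ih =>
        have h1 := ih (by omega)
        have h2 := hεF (f^[j] x) ⟨hiter x hx j, hout j (by omega)⟩
        rw [Function.iterate_succ_apply']
        push_cast
        linarith
    have h1 := hdec n₀ le_rfl
    have h2 := (norm_nonneg _).trans (hFn (f^[n₀] x))
    rw [div_lt_iff₀ hε] at hn₀
    linarith
  obtain ⟨C₀, hC₀⟩ := hflip M
  set C := max C₀ 1 with hC
  have hC1 : 1 ≤ C := le_max_right _ _
  have hshort (x y : E) (hx : F x ≤ M) (hy : F y ≤ M) (k : ℕ) :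
      ‖f^[k] x - f^[k] y‖ ≤ C ^ k * ‖x - y‖ := by
    induction k with
    | zero => simp
    | succ k ih =>
      rw [Function.iterate_succ_apply', Function.iterate_succ_apply', pow_succ', mul_assoc]
      calc _ ≤ C₀ * ‖f^[k] x - f^[k] y‖ :=
            hC₀ _ _ ((hFn _).trans (hiter x hx k)) ((hFn _).trans (hiter y hy k))
        _ ≤ C * ‖f^[k] x - f^[k] y‖ := by gcongr; exact le_max_left _ _
        _ ≤ _ := by gcongr
  set K' := max K 1 with hK'
  have hK1 : 1 ≤ K' := le_max_right _ _
  refine ⟨K' * C ^ n₀ * (L' ^ n₀)⁻¹, fun x y hxR hyR k => ?_⟩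
  have hx := hM x hxR
  have hy := hM y hyR
  rcases le_total k n₀ with hk | hk
  · have h1 : 1 ≤ (L' ^ n₀)⁻¹ * L' ^ k := by
      rw [inv_mul_eq_div, one_le_div (by positivity)]
      exact pow_le_pow_of_le_one hL'0.le hL'1.le hk
    calc _ ≤ C ^ k * ‖x - y‖ := hshort x y hx hy k
      _ ≤ C ^ n₀ * ‖x - y‖ := by gcongr
      _ = 1 * C ^ n₀ * 1 * ‖x - y‖ := by ring
      _ ≤ K' * C ^ n₀ * ((L' ^ n₀)⁻¹ * L' ^ k) * ‖x - y‖ := by gcongr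
      _ = _ := by ring
  · obtain ⟨j, rfl⟩ := Nat.exists_eq_add_of_le' hk
    rw [Function.iterate_add_apply, Function.iterate_add_apply]
    calc _ ≤ N (f^[j] (f^[n₀] x) - f^[j] (f^[n₀] y)) := hnN _
      _ ≤ L ^ j * N (f^[n₀] x - f^[n₀] y) := hWc j _ _ (henter x hx) (henter y hy)
      _ ≤ L' ^ j * (K' * (C ^ n₀ * ‖x - y‖)) := by
        gcongr
        · exact le_max_left _ _
        · refine (hNK _).trans ?_
          gcongr
          · exact le_max_left _ _
          · exact hshort x y hx hy n₀
      _ = _ := by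
        rw [pow_add]
        field_simp

end Dynamics

/-! ### Global convergence of the iteration -/

section Potential

variable {n : ℕ}

/-- The strictly convex potential `tr e^{A[x]} - ∑ x_i`, whose gradient is `δ(x) - 1`. -/
def potential (A : Matrix (Fin n) (Fin n) ℝ) (x : Fin n → ℝ) : ℝ := ∑ i, (delta A x i - x i)

/-- Peierls' inequality: the weights `Q i k ^ 2` sum to `1` and average the eigenvalues to `x i`, so
this is Jensen's inequality for `exp`. -/
theorem exp_le_delta {A : Matrix (Fin n) (Fin n) ℝ} (hA : A.IsSymm) (x : Fin n → ℝ) (i : Fin n) :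
    Real.exp (x i) ≤ delta A x i := by
  obtain ⟨Q, hQ, l, h⟩ := exists_spectral_decomposition (withDiag_isSymm hA x)
  have h1 : Q * Qᵀ = 1 := (Matrix.mem_orthogonalGroup_iff (Fin n) ℝ).1 hQ
  have h2 : ∑ k, Q i k ^ 2 = 1 := by
    have := congrFun (congrFun h1 i) i
    rw [Matrix.mul_apply, Matrix.one_apply_eq] at this
    rw [← this]
    exact Finset.sum_congr rfl fun k _ => sq _
  have h3 : ∑ k, l k * Q i k ^ 2 = x i := by
    have := congrFun (congrFun h i) i
    rw [Matrix.mul_apply] at this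
    have hx : withDiag A x i i = x i := by simp [withDiag]
    rw [← hx, this]
    refine Finset.sum_congr rfl fun k _ => ?_
    rw [Matrix.mul_diagonal, Matrix.transpose_apply]
    ring
  have h4 (k : Fin n) : Real.exp (x i) * (1 + l k - x i) ≤ Real.exp (l k) := by
    have h5 := Real.add_one_le_exp (l k - x i)
    have h6 : Real.exp (l k) = Real.exp (x i) * Real.exp (l k - x i) := by
      rw [← Real.exp_add]; congr 1; ring
    rw [h6]
    gcongr
    linarith
  rw [delta_eq hQ h]
  calc Real.exp (x i) = Real.exp (x i) * ((1 - x i) * ∑ k, Q i k ^ 2 + ∑ k, l k * Q i k ^ 2) := by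
        rw [h2, h3]; ring
    _ = ∑ k, Real.exp (x i) * (1 + l k - x i) * Q i k ^ 2 := by
        rw [Finset.mul_sum, ← Finset.sum_add_distrib, Finset.mul_sum]
        exact Finset.sum_congr rfl fun k _ => by ring
    _ ≤ _ := Finset.sum_le_sum fun k _ => by gcongr; exact h4 k

theorem abs_le_exp_sub (t : ℝ) : |t| ≤ Real.exp t - t := by
  rcases le_total 0 t with h | h
  · rw [abs_of_nonneg h]
    nlinarith [Real.quadratic_le_exp_of_nonneg h, sq_nonneg (t - 1)]
  · rw [abs_of_nonpos h]
    linarith [Real.exp_pos t]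

theorem norm_le_potential {A : Matrix (Fin n) (Fin n) ℝ} (hA : A.IsSymm) (x : Fin n → ℝ) :
    ‖x‖ ≤ potential A x := by
  have h1 (i : Fin n) : |x i| ≤ delta A x i - x i := by
    linarith [abs_le_exp_sub (x i), exp_le_delta hA x i]
  have h2 (i : Fin n) : 0 ≤ delta A x i - x i := (abs_nonneg _).trans (h1 i)
  refine (pi_norm_le_iff_of_nonneg (Finset.sum_nonneg fun i _ => h2 i)).2 fun i => ?_
  exact (h1 i).trans (Finset.single_le_sum (f := fun i => delta A x i - x i) (fun i _ => h2 i)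
    (Finset.mem_univ i))

/-- By the Golden–Thompson inequality, `tr e^{A[g(x)]} ≤ tr (e^{A[x]} D⁻¹) = n`. -/
theorem sum_delta_g_le {A : Matrix (Fin n) (Fin n) ℝ} (hA : A.IsSymm) (x : Fin n → ℝ) :
    ∑ i, delta A (g A x) i ≤ n := by
  have h1 : withDiag A (g A x) = withDiag A x + diagonal (fun i => -Real.log (delta A x i)) := by
    rw [withDiag_eq_add A (g A x), withDiag_eq_add A x, add_assoc, Matrix.diagonal_add]
    rfl
  have h2 : NormedSpace.exp (diagonal fun i => -Real.log (delta A x i)) =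
      diagonal fun i => (delta A x i)⁻¹ := by
    rw [Matrix.exp_diagonal, Pi.exp_def, ← Real.exp_eq_exp_ℝ]
    congr 1
    ext i
    rw [Real.exp_neg, Real.exp_log (delta_pos hA x i)]
  calc ∑ i, delta A (g A x) i = (NormedSpace.exp (withDiag A (g A x))).trace := rfl
    _ ≤ (NormedSpace.exp (withDiag A x) *
          NormedSpace.exp (diagonal fun i => -Real.log (delta A x i))).trace := by
        rw [h1]
        exact trace_exp_add_le (withDiag_isSymm hA x) (Matrix.isSymm_diagonal _)
    _ = ∑ i, delta A x i * (delta A x i)⁻¹ := by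
        rw [h2]
        exact Finset.sum_congr rfl fun i _ => by rw [Matrix.diag_apply, Matrix.mul_diagonal]; rfl
    _ = n := by
        simp [mul_inv_cancel₀ (delta_pos hA x _).ne']

theorem potential_g_lt {A : Matrix (Fin n) (Fin n) ℝ} (hA : A.IsSymm) {x : Fin n → ℝ}
    (hx : delta A x ≠ 1) : potential A (g A x) < potential A x := by
  have h1 := sum_delta_g_le hA x
  have h2 : ∑ i, (1 + Real.log (delta A x i)) < ∑ i, delta A x i := by
    obtain ⟨i, hi⟩ := Function.ne_iff.1 hx
    refine Finset.sum_lt_sum (fun i _ => ?_) ⟨i, Finset.mem_univ i, ?_⟩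
    · linarith [Real.log_le_sub_one_of_pos (delta_pos hA x i)]
    · linarith [Real.log_lt_sub_one_of_pos (delta_pos hA x i) hi]
  simp only [Finset.sum_add_distrib, Finset.sum_const, Finset.card_univ, Fintype.card_fin,
    nsmul_eq_mul, mul_one] at h2
  have h3 : ∑ i, g A x i = ∑ i, x i - ∑ i, Real.log (delta A x i) := Finset.sum_sub_distrib _ _
  simp only [potential, Finset.sum_sub_distrib]
  linarith

theorem g_eq_self {A : Matrix (Fin n) (Fin n) ℝ} {x : Fin n → ℝ} (hx : delta A x = 1) :
    g A x = x := by
  ext i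
  simp [g, hx]

theorem continuous_delta (A : Matrix (Fin n) (Fin n) ℝ) : Continuous (delta A) :=
  continuous_iff_continuousAt.2 fun x => (hasStrictFDerivAt_delta A x).continuousAt

theorem continuous_potential (A : Matrix (Fin n) (Fin n) ℝ) : Continuous (potential A) :=
  continuous_finsetSum _ fun i _ =>
    ((continuous_apply i).comp (continuous_delta A)).sub (continuous_apply i)

/-- A minimiser of the coercive potential satisfies `δ = 1`, since otherwise `g` would decrease the
potential further. -/
theorem exists_delta_eq_one {A : Matrix (Fin n) (Fin n) ℝ} (hA : A.IsSymm) :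
    ∃ x, delta A x = 1 := by
  obtain ⟨x, hx⟩ := (continuous_potential A).exists_forall_le
    (Filter.tendsto_atTop_mono (norm_le_potential hA) (tendsto_norm_cocompact_atTop (E := Fin n → ℝ)))
  refine ⟨x, by_contra fun h => ?_⟩
  exact absurd (hx (g A x)) (not_le.2 (potential_g_lt hA h))

/-- Along the segment from `x` to `y`, the function `(y - x) ⬝ δ` has positive derivative because the
Jacobian matrix of `δ` is positive definite. -/
theorem delta_injective {A : Matrix (Fin n) (Fin n) ℝ} (hA : A.IsSymm) :
    Function.Injective (delta A) := by
  intro x y hxy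
  by_contra hne
  have hv : y - x ≠ 0 := sub_ne_zero.2 (Ne.symm hne)
  set v := y - x with hvdef
  have hd (t : ℝ) : ∃ c > 0, HasDerivAt (fun t : ℝ => v ⬝ᵥ delta A (x + t • v)) c t := by
    obtain ⟨Q, hQ, l, h⟩ := exists_spectral_decomposition (withDiag_isSymm hA (x + t • v))
    refine ⟨_, dotProduct_deltaJac_mulVec_pos hQ l hv, ?_⟩
    have hp : HasDerivAt (fun t : ℝ => x + t • v) v t := by
      simpa using ((hasDerivAt_id t).smul_const v).const_add x
    have h1 := (hasStrictFDerivAt_delta_of_eq hQ h).hasFDerivAt.comp_hasDerivAt t hp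
    exact HasDerivAt.fun_sum fun i _ => (hasDerivAt_pi.1 h1 i).const_mul (v i)
  have hm : StrictMono fun t : ℝ => v ⬝ᵥ delta A (x + t • v) :=
    strictMono_of_deriv_pos fun t => by
      obtain ⟨c, hc, h⟩ := hd t
      rwa [h.deriv]
  have h01 := hm zero_lt_one
  simp only [zero_smul, add_zero, one_smul, hvdef, add_sub_cancel, hxy, lt_irrefl] at h01

theorem locallyLipschitz_g {A : Matrix (Fin n) (Fin n) ℝ} (hA : A.IsSymm) :
    LocallyLipschitz (g A) := by
  intro x
  obtain ⟨Q, hQ, l, h⟩ := exists_spectral_decomposition (withDiag_isSymm hA x)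
  exact (hasStrictFDerivAt_g hA hQ h).exists_lipschitzOnWith

theorem exists_metricSpace_g {A : Matrix (Fin n) (Fin n) ℝ} (hA : A.IsSymm) :
    ∃ (d : MetricSpace (Fin n → ℝ)) (L : ℝ),
      d.toUniformSpace.toTopologicalSpace = Pi.topologicalSpace ∧
      @CompleteSpace (Fin n → ℝ) d.toUniformSpace ∧
      (∀ x y : Fin n → ℝ, ‖x - y‖ ≤ d.dist x y) ∧
      (∀ R : ℝ, ∃ C : ℝ, ∀ x y : Fin n → ℝ, ‖x‖ ≤ R → ‖y‖ ≤ R → d.dist x y ≤ C * ‖x - y‖) ∧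
      0 ≤ L ∧ L < 1 ∧
      ∀ x y : Fin n → ℝ, d.dist (g A x) (g A y) ≤ L * d.dist x y := by
  obtain ⟨x₀, hx₀⟩ := exists_delta_eq_one hA
  obtain ⟨L, hL0, hL1, U, hU, hUL⟩ := g_locally_contracting hA x₀
  have hd (i : Fin n) : 0 ≤ delta A x₀ i := (delta_pos hA x₀ i).le
  obtain ⟨L', hL'0, hL'1, hL'⟩ := exists_iterate_contracting (F := potential A)
    (locallyLipschitz_g hA).continuous
    (fun R => by
      obtain ⟨C, hC⟩ := LocallyLipschitzOn.exists_lipschitzOnWith_of_compact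
        (isCompact_closedBall (0 : Fin n → ℝ) R) (locallyLipschitz_g hA).locallyLipschitzOn
      refine ⟨C, fun x y hx hy => ?_⟩
      have := hC.dist_le_mul x (by simpa using hx) y (by simpa using hy)
      rwa [dist_eq_norm, dist_eq_norm] at this)
    (continuous_potential A) (norm_le_potential hA) (g_eq_self hx₀)
    (fun x hx => potential_g_lt hA fun h => hx (delta_injective hA (h.trans hx₀.symm)))
    (weightedSeminorm (delta A x₀)) (continuous_weightedSeminorm hd)
    (fun v => by
      rw [weightedSeminorm_apply hd, hx₀]
      refine (pi_norm_le_iff_of_nonneg (Real.sqrt_nonneg _)).2 fun i => Real.abs_le_sqrt ?_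
      simp only [Pi.one_apply, one_mul]
      exact Finset.single_le_sum (f := fun i => v i ^ 2) (fun i _ => sq_nonneg _)
        (Finset.mem_univ i))
    hL0 hL1 hU hUL
  obtain ⟨d, h1, h2, h3, h4, h5⟩ := exists_metricSpace_contracting (g A) hL'0 hL'
  exact ⟨d, L', h1, h2, h3, h4, hL'0.le, hL'1, h5⟩

end Potential

end CorrParam

end

theorem lemma2 (n : ℕ) (A : Matrix (Fin n) (Fin n) ℝ) (hA : A.IsSymm) :
    (∀ x : Fin n → ℝ,
      (∀ i, 0 < CorrParam.delta A x i) ∧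
      DifferentiableAt ℝ (CorrParam.g A) x ∧
      (∀ (Q : Matrix (Fin n) (Fin n) ℝ) (l : Fin n → ℝ),
        Q ∈ Matrix.orthogonalGroup (Fin n) ℝ →
        CorrParam.withDiag A x = Q * Matrix.diagonal l * Q.transpose →
          CorrParam.jacobian (CorrParam.g A) x =
            CorrParam.invSqrtD (CorrParam.delta A x) *
              CorrParam.jTilde Q l (CorrParam.delta A x) *
              CorrParam.sqrtD (CorrParam.delta A x) ∧
          (∀ k m, 0 ≤ CorrParam.phi l k m) ∧
          (∀ k m, l k ≠ l m → 0 < CorrParam.phi l k m) ∧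
          (CorrParam.jTilde Q l (CorrParam.delta A x)).PosSemidef) ∧
      (∀ μ ∈ spectrum ℂ ((CorrParam.jacobian (CorrParam.g A) x).map (algebraMap ℝ ℂ)),
        ∃ r : ℝ, 0 ≤ r ∧ r < 1 ∧ μ = (r : ℂ)) ∧
      (∃ L : ℝ, 0 ≤ L ∧ L < 1 ∧ ∃ U ∈ 𝓝 x, ∀ y ∈ U, ∀ z ∈ U,
        Real.sqrt (∑ i, CorrParam.delta A x i * (CorrParam.g A y i - CorrParam.g A z i) ^ 2) ≤
          L * Real.sqrt (∑ i, CorrParam.delta A x i * (y i - z i) ^ 2))) ∧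
    (∃ (d : MetricSpace (Fin n → ℝ)) (L : ℝ),
      d.toUniformSpace.toTopologicalSpace = Pi.topologicalSpace ∧
      @CompleteSpace (Fin n → ℝ) d.toUniformSpace ∧
      (∀ x y : Fin n → ℝ, ‖x - y‖ ≤ d.dist x y) ∧
      (∀ R : ℝ, ∃ C : ℝ, ∀ x y : Fin n → ℝ, ‖x‖ ≤ R → ‖y‖ ≤ R → d.dist x y ≤ C * ‖x - y‖) ∧
      0 ≤ L ∧ L < 1 ∧
      ∀ x y : Fin n → ℝ,
        d.dist (CorrParam.g A x) (CorrParam.g A y) ≤ L * d.dist x y) := by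
  refine ⟨fun x => ?_, CorrParam.exists_metricSpace_g hA⟩
  have hpos := CorrParam.delta_pos hA x
  have hJ {Q : Matrix (Fin n) (Fin n) ℝ} {l : Fin n → ℝ}
      (hQ : Q ∈ Matrix.orthogonalGroup (Fin n) ℝ)
      (h : CorrParam.withDiag A x = Q * Matrix.diagonal l * Q.transpose) :
      CorrParam.jacobian (CorrParam.g A) x =
        Matrix.diagonal (fun i => (CorrParam.delta A x i)⁻¹) * CorrParam.gapMatrix Q l := by
    rw [CorrParam.jacobian, (CorrParam.hasStrictFDerivAt_g hA hQ h).hasFDerivAt.fderiv]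
    exact LinearMap.toMatrix'_toLin' _
  obtain ⟨Q, hQ, l, h⟩ :=
    CorrParam.exists_spectral_decomposition (CorrParam.withDiag_isSymm hA x)
  refine ⟨hpos, (CorrParam.hasStrictFDerivAt_g hA hQ h).hasFDerivAt.differentiableAt,
    fun Q l hQ h => ⟨?_, CorrParam.phi_nonneg l, fun k m => CorrParam.phi_pos l,
      CorrParam.jTilde_posSemidef Q l _⟩, fun μ hμ => ?_, ?_⟩
  · rw [hJ hQ h, CorrParam.invSqrtD_mul_jTilde_mul_sqrtD Q l hpos]
  · rw [hJ hQ h] at hμ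
    exact CorrParam.spectrum_diagonal_inv_mul (CorrParam.gapMatrix_posSemidef Q l) hpos
      (CorrParam.dotProduct_gapMatrix_mulVec_lt hQ h) hμ
  · obtain ⟨L, hL0, hL1, U, hU, hUL⟩ := CorrParam.g_locally_contracting hA x
    refine ⟨L, hL0, hL1, U, hU, fun y hy z hz => ?_⟩
    have := hUL y hy z hz
    rwa [CorrParam.weightedSeminorm_apply fun i => (hpos i).le,
      CorrParam.weightedSeminorm_apply fun i => (hpos i).le] at this
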